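/- Functions on $S^1$ are $2\pi$-periodic functions of $\theta$; $\dot\chi=\partial_t\chi$, $\chi'=\partial_\theta\chi$. **Unknowns.** Let $0<t_0<T$ and let $V\in C^\infty(\mathbb R)$ with $V>0$, $V'(0)=0$, $V''(0)>0$. A regular set of fields on $[t_0,T)\times S^1$ is $u=(\alpha,\tau,\mu,A,G,H,J,K,\phi,f)$ with $\alpha>0,\tau,\mu,A,G,H,\phi$ of class $C^2$ and $J,K$ of class $C^1$ on $[t_0,T)\times S^1$, and $f(t,\theta,v)\ge 0$ of class $C^1$ on $[t_0,T)\times S^1\times\mathbb R^3$ whose support in $v$ is bounded uniformly in $\theta$ and locally uniformly in $t$. Put $v^0=\sqrt{1+|v|^2}$, $e^{\beta}=\sqrt\alpha\,e^{\tau}$, $\partial_\varsigma=\partial_t+\sqrt\alpha\,\partial_\theta$, $\partial_\xi=\partial_t-\sqrt\alpha\,\partial_\theta$, $\chi_\varsigma=\partial_\varsigma\chi$, $\chi_\xi=\partial_\xi\chi$, and $$\Upsilon=\dot\mu^2+\alpha\mu'^2+\tfrac{e^{4\mu}}{4t^2}(\dot A^2+\alpha A'^2),\qquad \Upsilon^\times=2\sqrt\alpha\,(\dot\mu\mu'+\tfrac{e^{4\mu}}{4t^2}\dot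 A A').$$ Matter quantities of a distribution function $g$ and fields $u$ (orthonormal frame components): $$\rho=8\pi\!\int\! v^0 g\,dv+\tfrac12e^{-2(\tau-\mu)}\big(\tfrac{\dot\phi^2}{\alpha}+\phi'^2\big)+V(\phi),\qquad \rho_1=8\pi\!\int\! v^1 g\,dv-e^{-2(\tau-\mu)}\tfrac{\dot\phi\,\phi'}{\sqrt\alpha},$$ $$P_1=8\pi\!\int\!\tfrac{(v^1)^2}{v^0}g\,dv+\tfrac12e^{-2(\tau-\mu)}\big(\tfrac{\dot\phi^2}{\alpha}+\phi'^2\big)-V(\phi),\quad P_k=8\pi\!\int\!\tfrac{(v^k)^2}{v^0}g\,dv+\tfrac12e^{-2(\tau-\mu)}\big(\tfrac{\dot\phi^2}{\alpha}-\phi'^2\big)-V(\phi)\ (k=2,3),$$ $\rho_k=8\pi\int v^kg\,dv$ $(k=2,3)$, $S_{jk}=8\pi\int \frac{v^jv^k}{v^0}g\,dv$ $(j\ne k)$. **Iteration.** Regular initial data at $t=t_0$ are given: $2\pi$-periodic values $\alpha^\circ>0,\tau^\circ,\mu^\circ,A^\circ,G^\circ,H^\circ,\phi^\circ\in C^2$,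 $J^\circ,K^\circ\in C^1$, time derivatives $\grave\mu,\grave A,\grave\phi\in C^1$, and $0\le f^\circ\in C^1$, $2\pi$-periodic in $\theta$, with bounded momentum support. A sequence of iterates is a sequence $u_n$, $n\ge 0$, of regular sets of fields on $[t_0,T)\times S^1$ that all have the given initial values and for which, for each $n\ge1$, $(\dot\mu_n,\dot A_n,\dot\phi_n)(t_0)=(\grave\mu,\grave A,\grave\phi)$ and the following equations hold on $[t_0,T)\times S^1$. Unindexed fields (and $\beta,\partial_\xi,\partial_\varsigma,\Upsilon,\Upsilon^\times$) on the right of (1) and in (3)–(6), and the operators $\partial_\xi,\partial_\varsigma$ applied on the left of (3), (4), are those of $u_{n-1}$; the matter quantities in (2)–(4) are those of $f_n$ and $u_{n-1}$, those in (5) are those of $f_{n-1}$. (1) $f_n(t,\theta,v)=f^\circ(\Theta(t_0),W(t_0))$, where $(\Theta,W)$ solves, with $(\Theta,W)(t)=(\theta,v)$, writing $W^0=\sqrt{1+|W|^2}$ and with the fields taken at $(s,\Theta(s))$, $$\tfrac{d\Theta}{ds}=\sqrt\alpha\,\tfrac{W^1}{W^0},\qquad \tfrac{dW^2}{ds}=-\dot\mu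 W^2-\sqrt\alpha\,\mu'\tfrac{W^1W^2}{W^0},$$ $$\tfrac{dW^3}{ds}=-(\tfrac1s-\dot\mu)W^3+\sqrt\alpha\,\mu'\tfrac{W^1W^3}{W^0}-\tfrac{e^{2\mu}}{s}\big(\dot A+\sqrt\alpha A'\tfrac{W^1}{W^0}\big)W^2,$$ $$\tfrac{dW^1}{ds}=-(\tau'-\mu'+\tfrac{\alpha'}{2\alpha})\sqrt\alpha W^0-(\dot\tau-\dot\mu)W^1+\tfrac{\sqrt\alpha\mu'}{W^0}\big((W^2)^2-(W^3)^2\big)+\tfrac{\sqrt\alpha A'e^{2\mu}}{sW^0}W^2W^3+\tfrac{e^{\beta}}{s^2}(K-AJ)W^3+\tfrac{e^{\beta-2\mu}}{s}JW^2 .$$ (2) Constraint equations: $$\dot\tau_n=t\Upsilon_n+\tfrac{\alpha_ne^{2\tau_n-4\mu_n}}{4t}J_n^2+\tfrac{\alpha_ne^{2\tau_n}}{4t^3}(K_n-A_nJ_n)^2+t\alpha_ne^{2(\tau_n-\mu_n)}\rho,$$ $$\tfrac{\dot\alpha_n}{\alpha_n}=-\tfrac{\alpha_ne^{2\tau_n-4\mu_n}}{t}J_n^2-\tfrac{\alpha_ne^{2\tau_n}}{t^3}(K_n-A_nJ_n)^2-2t\alpha_ne^{2(\tau_n-\mu_n)}(\rho-P_1),$$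 $$\tau_n'=\tfrac{t\Upsilon_n^\times}{\sqrt{\alpha_n}}-\tfrac{\alpha_n'}{2\alpha_n}-t\sqrt{\alpha_n}e^{2(\tau_n-\mu_n)}\rho_1 .$$ (3) Wave equation for $\phi$, with $\phi_{\varsigma_n}=\dot\phi_n+\sqrt{\alpha_n}\phi_n'$, $\phi_{\xi_n}=\dot\phi_n-\sqrt{\alpha_n}\phi_n'$ and $\daleth=\frac{1}{2\sqrt\alpha}\big\{[2A'H(G-1)-\mu'(G+AH)^2]\alpha e^{-2(\tau-2\mu)}-4\mu'H^2t^2\alpha e^{-2\tau}\big\}$: $$\partial_{\xi}\phi_{\varsigma_n}=\big(\tfrac{\dot\alpha}{2\alpha}-\tfrac1{2t}+\daleth\big)\phi_{\varsigma}-\big(\tfrac1{2t}+\daleth\big)\phi_{\xi}-e^{2\beta-2\mu}V'(\phi),$$ $$\partial_{\varsigma}\phi_{\xi_n}=\big(\tfrac{\dot\alpha}{2\alpha}-\tfrac1{2t}-\daleth\big)\phi_{\xi}-\big(\tfrac1{2t}-\daleth\big)\phi_{\varsigma}-e^{2\beta-2\mu}V'(\phi).$$ (4) Wave equations for $\mu,A$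 in null form, with $m=\frac{e^{2\beta-4\mu}}{2t^2}J^2+\frac12e^{2\beta-2\mu}(\rho-P_1+P_2-P_3)$ and $a=\frac{e^{2\beta-4\mu}}{t^2}J(K-AJ)+2te^{2\beta-4\mu}S_{23}$: $$\partial_\xi(\Upsilon_n+\Upsilon_n^\times)=\tfrac{\dot\alpha}{\alpha}(\Upsilon+\Upsilon^\times)-\tfrac{\Upsilon^\times}{t}-\tfrac2t\big(\dot\mu^2+\tfrac{e^{4\mu}}{4t^2}\alpha A'^2\big)+2\mu_\varsigma m+\tfrac{e^{4\mu}}{2t^2}A_\varsigma a,$$ $$\partial_\varsigma(\Upsilon_n-\Upsilon_n^\times)=\tfrac{\dot\alpha}{\alpha}(\Upsilon-\Upsilon^\times)+\tfrac{\Upsilon^\times}{t}-\tfrac2t\big(\dot\mu^2+\tfrac{e^{4\mu}}{4t^2}\alpha A'^2\big)+2\mu_\xi m+\tfrac{e^{4\mu}}{2t^2}A_\xi a .$$ (5) Auxiliary equations: $J_n'=2te^{\tau}\rho_2$, $\ \dot J_n=-2te^{\beta}S_{12}$, $\ K_n'=2te^\tau(A\rho_2+te^{-2\mu}\rho_3)$,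 $\ \dot K_n=-2te^{\beta}(AS_{12}+te^{-2\mu}S_{13})$. (6) Twist quantities (all fields here are those of $u_n$): $J_n=-\frac{te^{-2\tau_n+4\mu_n}}{\sqrt{\alpha_n}}(\dot G_n+A_n\dot H_n)$, $K_n=A_nJ_n-\frac{t^3e^{-2\tau_n}}{\sqrt{\alpha_n}}\dot H_n$. **Proposition.** The first derivatives of $\mu_n$, $A_n$, $\phi_n$ are bounded uniformly in $n$: for given $V,t_0,T$, regular initial data and regular zeroth iterate $u_0$ there are $t_1\in(t_0,T)$ and $C$ such that every sequence of iterates starting with $u_0$ satisfies $$|\dot\mu_n|,\ |\mu_n'|,\ |\dot A_n|,\ |A_n'|,\ |\dot\phi_n|,\ |\phi_n'|\ \le\ C\qquad\text{on }(t_0,t_1]\times S^1,\ \text{for all } n\ge 0 .$$ -/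

import Mathlib

open MeasureTheory Set

noncomputable section

namespace T2EVS

/-- Momentum space. The coordinates are the components of the momentum in the orthonormal
frame; `v 0, v 1, v 2` are the components usually written v¹, v², v³. -/
abbrev Mom := Fin 3 → ℝ

/-- The potential of the scalar field: smooth, positive, with a nondegenerate critical point
at `0`. -/
structure IsPotential (V : ℝ → ℝ) : Prop where
  smooth : ContDiff ℝ (⊤ : ℕ∞) V
  pos : ∀ x, 0 < V x
  deriv_zero : deriv V 0 = 0
  deriv_deriv_pos : 0 < deriv (deriv V) 0

/-- Partial derivative in time, one-sided at an endpoint of the time interval `I` lying in `I`. -/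
def dt (I : Set ℝ) (χ : ℝ → ℝ → ℝ) (t θ : ℝ) : ℝ := derivWithin (fun s => χ s θ) I t

/-- Partial derivative in the angle. -/
def dθ (χ : ℝ → ℝ → ℝ) (t θ : ℝ) : ℝ := deriv (fun x => χ t x) θ

/-- The unknowns: the metric functions `α, τ, μ, A, G, H` and the twist quantities `J, K`
and the scalar field `φ`, all functions of `(t, θ)`, and the distribution function
`f (t, θ, v)`. -/
structure Fields where
  α : ℝ → ℝ → ℝ
  τ : ℝ → ℝ → ℝ
  μ : ℝ → ℝ → ℝ
  A : ℝ → ℝ → ℝ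
  G : ℝ → ℝ → ℝ
  H : ℝ → ℝ → ℝ
  J : ℝ → ℝ → ℝ
  K : ℝ → ℝ → ℝ
  φ : ℝ → ℝ → ℝ
  f : ℝ → ℝ → Mom → ℝ

/-- A function of class `C^k` on `I × S¹`, written as a function that is `2π`-periodic in `θ`. -/
def RegularOn (k : ℕ) (I : Set ℝ) (χ : ℝ → ℝ → ℝ) : Prop :=
  ContDiffOn ℝ k (fun p : ℝ × ℝ => χ p.1 p.2) (I ×ˢ univ) ∧
    ∀ t ∈ I, ∀ θ, χ t (θ + 2 * Real.pi) = χ t θ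

/-- A regular distribution function: nonnegative, `C¹`, periodic in `θ`, with momentum support
bounded uniformly in `θ` and locally uniformly in `t`. -/
def RegularDistribution (I : Set ℝ) (f : ℝ → ℝ → Mom → ℝ) : Prop :=
  ContDiffOn ℝ 1 (fun p : ℝ × ℝ × Mom => f p.1 p.2.1 p.2.2) (I ×ˢ univ) ∧
    (∀ t ∈ I, ∀ θ v, f t (θ + 2 * Real.pi) v = f t θ v) ∧
    (∀ t ∈ I, ∀ θ v, 0 ≤ f t θ v) ∧
    ∀ S ⊆ I, IsCompact S → ∃ R : ℝ, ∀ t ∈ S, ∀ θ v, f t θ v ≠ 0 → ‖v‖ ≤ R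

/-- Regularity of all unknowns on `I × S¹`. -/
structure Fields.IsRegular (I : Set ℝ) (u : Fields) : Prop where
  α : RegularOn 2 I u.α
  α_pos : ∀ t ∈ I, ∀ θ, 0 < u.α t θ
  τ : RegularOn 2 I u.τ
  μ : RegularOn 2 I u.μ
  A : RegularOn 2 I u.A
  G : RegularOn 2 I u.G
  H : RegularOn 2 I u.H
  J : RegularOn 1 I u.J
  K : RegularOn 1 I u.K
  φ : RegularOn 2 I u.φ
  f : RegularDistribution I u.f

/-- Initial data at `t = t₀`: the values of all unknowns, and the time derivatives of the
functions `μ, A, φ`, which satisfy second order equations. -/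
structure InitialData where
  α : ℝ → ℝ
  τ : ℝ → ℝ
  μ : ℝ → ℝ
  A : ℝ → ℝ
  G : ℝ → ℝ
  H : ℝ → ℝ
  J : ℝ → ℝ
  K : ℝ → ℝ
  φ : ℝ → ℝ
  μ' : ℝ → ℝ
  A' : ℝ → ℝ
  φ' : ℝ → ℝ
  f : ℝ → Mom → ℝ

/-- A `2π`-periodic function of class `C^k`. -/
def RegularDatum (k : ℕ) (χ : ℝ → ℝ) : Prop :=
  ContDiff ℝ k χ ∧ Function.Periodic χ (2 * Real.pi)

structure InitialData.IsRegular (D : InitialData) : Prop where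
  α : RegularDatum 2 D.α
  α_pos : ∀ θ, 0 < D.α θ
  τ : RegularDatum 2 D.τ
  μ : RegularDatum 2 D.μ
  A : RegularDatum 2 D.A
  G : RegularDatum 2 D.G
  H : RegularDatum 2 D.H
  J : RegularDatum 1 D.J
  K : RegularDatum 1 D.K
  φ : RegularDatum 2 D.φ
  μ' : RegularDatum 1 D.μ'
  A' : RegularDatum 1 D.A'
  φ' : RegularDatum 1 D.φ'
  f_smooth : ContDiff ℝ 1 (fun p : ℝ × Mom => D.f p.1 p.2)
  f_periodic : ∀ θ v, D.f (θ + 2 * Real.pi) v = D.f θ v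
  f_nonneg : ∀ θ v, 0 ≤ D.f θ v
  f_support : ∃ R : ℝ, ∀ θ v, D.f θ v ≠ 0 → ‖v‖ ≤ R

/-! ### Null derivatives and quadratic quantities -/

/-- `β = τ + (log α) / 2`, that is `e ^ β = √α e ^ τ`. -/
def Fields.β (u : Fields) (t θ : ℝ) : ℝ := u.τ t θ + Real.log (u.α t θ) / 2

/-- `∂_ς χ = ∂_t χ + √α ∂_θ χ`, for the metric of `u`. -/
def Fields.dς (I : Set ℝ) (u : Fields) (χ : ℝ → ℝ → ℝ) (t θ : ℝ) : ℝ :=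
  dt I χ t θ + √(u.α t θ) * dθ χ t θ

/-- `∂_ξ χ = ∂_t χ - √α ∂_θ χ`, for the metric of `u`. -/
def Fields.dξ (I : Set ℝ) (u : Fields) (χ : ℝ → ℝ → ℝ) (t θ : ℝ) : ℝ :=
  dt I χ t θ - √(u.α t θ) * dθ χ t θ

/-- `Υ = μ_t² + α μ_θ² + e^{4μ} (A_t² + α A_θ²) / (4t²)`. -/
def Fields.Υ (I : Set ℝ) (u : Fields) (t θ : ℝ) : ℝ :=
  dt I u.μ t θ ^ 2 + u.α t θ * dθ u.μ t θ ^ 2 +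
    Real.exp (4 * u.μ t θ) / (4 * t ^ 2) * (dt I u.A t θ ^ 2 + u.α t θ * dθ u.A t θ ^ 2)

/-- `Υ^× = 2 √α (μ_t μ_θ + e^{4μ} A_t A_θ / (4t²))`. -/
def Fields.Υx (I : Set ℝ) (u : Fields) (t θ : ℝ) : ℝ :=
  2 * √(u.α t θ) * (dt I u.μ t θ * dθ u.μ t θ +
    Real.exp (4 * u.μ t θ) / (4 * t ^ 2) * (dt I u.A t θ * dθ u.A t θ))

/-! ### Matter quantities -/

/-- `v⁰`, the energy of a particle of unit mass with momentum `v`. -/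
def energy (v : Mom) : ℝ := √(1 + v 0 ^ 2 + v 1 ^ 2 + v 2 ^ 2)

/-- The velocity moment `8π ∫ w(v) f(t, θ, v) dv`. -/
def moment (f : ℝ → ℝ → Mom → ℝ) (w : Mom → ℝ) (t θ : ℝ) : ℝ :=
  8 * Real.pi * ∫ v : Mom, w v * f t θ v

/-- Half of `e^{-2(τ-μ)} (φ_t² / α + φ_θ²)`. -/
def Fields.kin (I : Set ℝ) (u : Fields) (t θ : ℝ) : ℝ :=
  Real.exp (-2 * (u.τ t θ - u.μ t θ)) *
    (dt I u.φ t θ ^ 2 / u.α t θ + dθ u.φ t θ ^ 2) / 2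

/-- Half of `e^{-2(τ-μ)} (φ_t² / α - φ_θ²)`. -/
def Fields.lag (I : Set ℝ) (u : Fields) (t θ : ℝ) : ℝ :=
  Real.exp (-2 * (u.τ t θ - u.μ t θ)) *
    (dt I u.φ t θ ^ 2 / u.α t θ - dθ u.φ t θ ^ 2) / 2

/- Components of the energy-momentum tensor in the orthonormal frame, for the distribution
function `f` and for the metric and the scalar field of `u`. -/

/-- Energy density `ρ`. -/
def Fields.ρ (I : Set ℝ) (V : ℝ → ℝ) (u : Fields) (f : ℝ → ℝ → Mom → ℝ) (t θ : ℝ) : ℝ :=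
  moment f energy t θ + u.kin I t θ + V (u.φ t θ)

/-- Momentum density `ρ₁`. -/
def Fields.ρ₁ (I : Set ℝ) (u : Fields) (f : ℝ → ℝ → Mom → ℝ) (t θ : ℝ) : ℝ :=
  moment f (fun v => v 0) t θ -
    Real.exp (-2 * (u.τ t θ - u.μ t θ)) * dt I u.φ t θ * dθ u.φ t θ / √(u.α t θ)

/-- Pressure `P₁`. -/
def Fields.P₁ (I : Set ℝ) (V : ℝ → ℝ) (u : Fields) (f : ℝ → ℝ → Mom → ℝ) (t θ : ℝ) : ℝ :=
  moment f (fun v => v 0 ^ 2 / energy v) t θ + u.kin I t θ - V (u.φ t θ)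

/-- Pressure `P₂`. -/
def Fields.P₂ (I : Set ℝ) (V : ℝ → ℝ) (u : Fields) (f : ℝ → ℝ → Mom → ℝ) (t θ : ℝ) : ℝ :=
  moment f (fun v => v 1 ^ 2 / energy v) t θ + u.lag I t θ - V (u.φ t θ)

/-- Pressure `P₃`. -/
def Fields.P₃ (I : Set ℝ) (V : ℝ → ℝ) (u : Fields) (f : ℝ → ℝ → Mom → ℝ) (t θ : ℝ) : ℝ :=
  moment f (fun v => v 2 ^ 2 / energy v) t θ + u.lag I t θ - V (u.φ t θ)

/-- Momentum densities `ρ₂`, `ρ₃` and stresses `S₁₂`, `S₁₃`, `S₂₃`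
(the scalar field does not contribute). -/
def ρ₂ (f : ℝ → ℝ → Mom → ℝ) : ℝ → ℝ → ℝ := moment f (fun v => v 1)

def ρ₃ (f : ℝ → ℝ → Mom → ℝ) : ℝ → ℝ → ℝ := moment f (fun v => v 2)

def S₁₂ (f : ℝ → ℝ → Mom → ℝ) : ℝ → ℝ → ℝ := moment f (fun v => v 0 * v 1 / energy v)

def S₁₃ (f : ℝ → ℝ → Mom → ℝ) : ℝ → ℝ → ℝ := moment f (fun v => v 0 * v 2 / energy v)

def S₂₃ (f : ℝ → ℝ → Mom → ℝ) : ℝ → ℝ → ℝ := moment f (fun v => v 1 * v 2 / energy v)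

/-! ### The Vlasov equation -/

/-- The `θ`-component of the characteristic vector field of the Vlasov equation. -/
def Fields.Ξ₀ (u : Fields) (s θ : ℝ) (v : Mom) : ℝ := √(u.α s θ) * v 0 / energy v

/-- The momentum components of the characteristic vector field of the Vlasov equation. -/
def Fields.Ξ (I : Set ℝ) (u : Fields) (s θ : ℝ) (v : Mom) : Mom :=
  ![ -(dθ u.τ s θ - dθ u.μ s θ + dθ u.α s θ / (2 * u.α s θ)) * √(u.α s θ) * energy v
      - (dt I u.τ s θ - dt I u.μ s θ) * v 0
      + √(u.α s θ) * dθ u.μ s θ / energy v * (v 1 ^ 2 - v 2 ^ 2)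
      + √(u.α s θ) * dθ u.A s θ / (s * energy v) * Real.exp (2 * u.μ s θ) * v 1 * v 2
      + √(u.α s θ) * Real.exp (u.τ s θ) / s ^ 2 * (u.K s θ - u.A s θ * u.J s θ) * v 2
      + √(u.α s θ) * Real.exp (u.τ s θ - 2 * u.μ s θ) / s * u.J s θ * v 1,
     -(dt I u.μ s θ) * v 1 - √(u.α s θ) * dθ u.μ s θ * v 0 * v 1 / energy v,
     -(1 / s - dt I u.μ s θ) * v 2 + √(u.α s θ) * dθ u.μ s θ * v 0 * v 2 / energy v
      - Real.exp (2 * u.μ s θ) / s *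
        (dt I u.A s θ + √(u.α s θ) * dθ u.A s θ * v 0 / energy v) * v 1 ]

/-- `f` is the solution with initial datum `f₀` at time `t₀` of the Vlasov equation in the
metric of `u`: the value `f (t, θ, v)` is the value of `f₀` at the point where the characteristic
through `(θ, v)` at time `t` starts at time `t₀`. -/
def SolvesVlasov (I : Set ℝ) (t₀ : ℝ) (u : Fields) (f₀ : ℝ → Mom → ℝ)
    (f : ℝ → ℝ → Mom → ℝ) : Prop :=
  ∀ t ∈ I, ∀ θ v, ∃ (Θ : ℝ → ℝ) (W : ℝ → Mom),
    (∀ s ∈ Icc t₀ t, HasDerivWithinAt Θ (u.Ξ₀ s (Θ s) (W s)) (Icc t₀ t) s) ∧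
    (∀ s ∈ Icc t₀ t, HasDerivWithinAt W (u.Ξ I s (Θ s) (W s)) (Icc t₀ t) s) ∧
    Θ t = θ ∧ W t = v ∧ f t θ v = f₀ (Θ t₀) (W t₀)

/-! ### One step of the iteration -/

/-- The coefficient of `φ_ς - φ_ξ` in the wave equation that comes from the shifts `G, H`. -/
def Fields.shift (u : Fields) (t θ : ℝ) : ℝ :=
  ((2 * dθ u.A t θ * u.H t θ * (u.G t θ - 1)
      - dθ u.μ t θ * (u.G t θ + u.A t θ * u.H t θ) ^ 2)
      * u.α t θ * Real.exp (-2 * (u.τ t θ - 2 * u.μ t θ))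
    - 4 * dθ u.μ t θ * u.H t θ ^ 2 * t ^ 2 * u.α t θ * Real.exp (-2 * u.τ t θ))
    / (2 * √(u.α t θ))

/-- The twist and matter source in the wave equation for `μ`. -/
def Fields.sourceμ (I : Set ℝ) (V : ℝ → ℝ) (u : Fields) (f : ℝ → ℝ → Mom → ℝ) (t θ : ℝ) : ℝ :=
  Real.exp (2 * u.β t θ - 4 * u.μ t θ) / (2 * t ^ 2) * u.J t θ ^ 2 +
    Real.exp (2 * u.β t θ - 2 * u.μ t θ) / 2 *
      (u.ρ I V f t θ - u.P₁ I V f t θ + u.P₂ I V f t θ - u.P₃ I V f t θ)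

/-- The twist and matter source in the wave equation for `A`. -/
def Fields.sourceA (u : Fields) (f : ℝ → ℝ → Mom → ℝ) (t θ : ℝ) : ℝ :=
  Real.exp (2 * u.β t θ - 4 * u.μ t θ) / t ^ 2 *
      (u.J t θ * (u.K t θ - u.A t θ * u.J t θ)) +
    2 * t * Real.exp (2 * u.β t θ - 4 * u.μ t θ) * S₂₃ f t θ

/-- `w` is an iterate that follows the iterate `u`, on the time interval `I`, with initial data
`D` at `t₀`. -/
structure IsStep (V : ℝ → ℝ) (I : Set ℝ) (t₀ : ℝ) (D : InitialData) (u w : Fields) : Prop where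
  /-- initial time derivatives -/
  initial : ∀ θ, dt I w.μ t₀ θ = D.μ' θ ∧ dt I w.A t₀ θ = D.A' θ ∧ dt I w.φ t₀ θ = D.φ' θ
  /-- the Vlasov equation in the previous metric -/
  vlasov : SolvesVlasov I t₀ u D.f w.f
  /-- the constraint equation for `τ_t` -/
  τ_t : ∀ t ∈ I, ∀ θ, dt I w.τ t θ = t * w.Υ I t θ
    + w.α t θ * Real.exp (2 * w.τ t θ - 4 * w.μ t θ) / (4 * t) * w.J t θ ^ 2
    + w.α t θ * Real.exp (2 * w.τ t θ) / (4 * t ^ 3) * (w.K t θ - w.A t θ * w.J t θ) ^ 2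
    + t * w.α t θ * Real.exp (2 * (w.τ t θ - w.μ t θ)) * u.ρ I V w.f t θ
  /-- the constraint equation for `α_t` -/
  α_t : ∀ t ∈ I, ∀ θ, dt I w.α t θ / w.α t θ =
    - (w.α t θ * Real.exp (2 * w.τ t θ - 4 * w.μ t θ) / t * w.J t θ ^ 2)
    - w.α t θ * Real.exp (2 * w.τ t θ) / t ^ 3 * (w.K t θ - w.A t θ * w.J t θ) ^ 2
    - 2 * t * w.α t θ * Real.exp (2 * (w.τ t θ - w.μ t θ))
        * (u.ρ I V w.f t θ - u.P₁ I V w.f t θ)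
  /-- the constraint equation for `τ_θ` -/
  τ_θ : ∀ t ∈ I, ∀ θ, dθ w.τ t θ = t * w.Υx I t θ / √(w.α t θ)
    - dθ w.α t θ / (2 * w.α t θ)
    - t * √(w.α t θ) * Real.exp (2 * (w.τ t θ - w.μ t θ)) * u.ρ₁ I w.f t θ
  /-- the wave equation for `φ`, along the first family of null paths -/
  φ_ξ : ∀ t ∈ I, ∀ θ, u.dξ I (w.dς I w.φ) t θ =
    (dt I u.α t θ / (2 * u.α t θ) - 1 / (2 * t) + u.shift t θ) * u.dς I u.φ t θ
    - (1 / (2 * t) + u.shift t θ) * u.dξ I u.φ t θ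
    - Real.exp (2 * u.β t θ - 2 * u.μ t θ) * deriv V (u.φ t θ)
  /-- the wave equation for `φ`, along the second family of null paths -/
  φ_ς : ∀ t ∈ I, ∀ θ, u.dς I (w.dξ I w.φ) t θ =
    (dt I u.α t θ / (2 * u.α t θ) - 1 / (2 * t) - u.shift t θ) * u.dξ I u.φ t θ
    - (1 / (2 * t) - u.shift t θ) * u.dς I u.φ t θ
    - Real.exp (2 * u.β t θ - 2 * u.μ t θ) * deriv V (u.φ t θ)
  /-- the evolution of `Υ + Υ^×` along the first family of null paths -/
  Υ_ξ : ∀ t ∈ I, ∀ θ, u.dξ I (fun s x => w.Υ I s x + w.Υx I s x) t θ =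
    dt I u.α t θ / u.α t θ * (u.Υ I t θ + u.Υx I t θ) - u.Υx I t θ / t
    - 2 / t * (dt I u.μ t θ ^ 2
        + Real.exp (4 * u.μ t θ) / (4 * t ^ 2) * u.α t θ * dθ u.A t θ ^ 2)
    + 2 * u.dς I u.μ t θ * u.sourceμ I V w.f t θ
    + Real.exp (4 * u.μ t θ) / (2 * t ^ 2) * u.dς I u.A t θ * u.sourceA w.f t θ
  /-- the evolution of `Υ - Υ^×` along the second family of null paths -/
  Υ_ς : ∀ t ∈ I, ∀ θ, u.dς I (fun s x => w.Υ I s x - w.Υx I s x) t θ =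
    dt I u.α t θ / u.α t θ * (u.Υ I t θ - u.Υx I t θ) + u.Υx I t θ / t
    - 2 / t * (dt I u.μ t θ ^ 2
        + Real.exp (4 * u.μ t θ) / (4 * t ^ 2) * u.α t θ * dθ u.A t θ ^ 2)
    + 2 * u.dξ I u.μ t θ * u.sourceμ I V w.f t θ
    + Real.exp (4 * u.μ t θ) / (2 * t ^ 2) * u.dξ I u.A t θ * u.sourceA w.f t θ
  /-- the auxiliary equations for the twist quantities -/
  J_θ : ∀ t ∈ I, ∀ θ, dθ w.J t θ = 2 * t * Real.exp (u.τ t θ) * ρ₂ u.f t θ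
  J_t : ∀ t ∈ I, ∀ θ, dt I w.J t θ =
    -2 * t * √(u.α t θ) * Real.exp (u.τ t θ) * S₁₂ u.f t θ
  K_θ : ∀ t ∈ I, ∀ θ, dθ w.K t θ = 2 * t * Real.exp (u.τ t θ) *
    (u.A t θ * ρ₂ u.f t θ + t * Real.exp (-2 * u.μ t θ) * ρ₃ u.f t θ)
  K_t : ∀ t ∈ I, ∀ θ, dt I w.K t θ = -2 * t * √(u.α t θ) * Real.exp (u.τ t θ) *
    (u.A t θ * S₁₂ u.f t θ + t * Real.exp (-2 * u.μ t θ) * S₁₃ u.f t θ)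
  /-- the relation between the twist quantities and the shifts `G, H` -/
  twist_J : ∀ t ∈ I, ∀ θ, w.J t θ = -(t * Real.exp (-2 * w.τ t θ + 4 * w.μ t θ) / √(w.α t θ)) *
    (dt I w.G t θ + w.A t θ * dt I w.H t θ)
  twist_K : ∀ t ∈ I, ∀ θ, w.K t θ = w.A t θ * w.J t θ -
    t ^ 3 * Real.exp (-2 * w.τ t θ) / √(w.α t θ) * dt I w.H t θ

/-- All unknowns of `u` have the initial values `D` at time `t₀`. -/
def HasInitialValues (t₀ : ℝ) (D : InitialData) (u : Fields) : Prop :=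
  ∀ θ, u.α t₀ θ = D.α θ ∧ u.τ t₀ θ = D.τ θ ∧ u.μ t₀ θ = D.μ θ ∧ u.A t₀ θ = D.A θ ∧
    u.G t₀ θ = D.G θ ∧ u.H t₀ θ = D.H θ ∧ u.J t₀ θ = D.J θ ∧ u.K t₀ θ = D.K θ ∧
    u.φ t₀ θ = D.φ θ ∧ ∀ v, u.f t₀ θ v = D.f θ v

/-- A sequence of regular iterates on `[t₀, T) × S¹` with initial data `D`. -/
structure IsIteration (V : ℝ → ℝ) (t₀ T : ℝ) (D : InitialData) (u : ℕ → Fields) : Prop where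
  regular : ∀ n, (u n).IsRegular (Ico t₀ T)
  initial : ∀ n, HasInitialValues t₀ D (u n)
  step : ∀ n, IsStep V (Ico t₀ T) t₀ D (u n) (u (n + 1))

end T2EVS

end

/-! The proof is an induction on `n` that propagates two families of bounds on a fixed short
interval: `FieldBound` with constant `M` for the fields, the matter distribution and the null
derivatives, and `RateBound` with constant `M'` for `α_t / α`, `τ_t` and `τ_θ + α_θ / (2α)`. The
desired first derivatives are read off from `FieldBound`. Indeed `Υ ± Υx` bound `Υ`, a sum of
squares that controls the derivatives of `μ` and `A`, while `φ_ς` and `φ_ξ` control those of `φ`.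

For one step (`exists_time_step`) the bounds on `u` give bounds on the next iterate `w` in a forced
order. Grönwall along characteristics bounds the momentum support of `w.f` (`exists_time_dist`). The
right-hand sides of the null equations and of the equations for `J_t`, `K_t` are then bounded, so `Υ
± Υx`, `φ_ς`, `φ_ξ`, `J`, `K` grow at most linearly in time. For the null equations this is a
maximum principle (`RegularOn.le_add_of_transport_le`), which replaces integration along null paths.
Next come `μ`, `φ` and `A`, from their time derivatives. The equations for `α_t` and `τ_t` are
nonlinear in the new unknowns, but only through the factor `α e^{2τ}`, and the comparison
`exists_time_pair_bound` controls that factor for a short time. The shifts `G`, `H` follow from the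
twist relations.

There is no circularity in the constants. The constraint equations express the quantities in
`RateBound` algebraically through quantities bounded by `M`, so `M'` is chosen after `M`
(`eventually_rateBound_step`), and the length of the interval after both. Uniformity in `n` comes
from stating each estimate as `BddOn` over the set of all samples that satisfy the given bounds: its
constant cannot depend on the iterate. -/

namespace T2EVS

/-! ### Uniformly bounded families of real numbers -/

/-- The family `g` is bounded on `S`. -/
def BddOn {ι : Type*} (S : Set ι) (g : ι → ℝ) : Prop := ∃ C : ℝ, ∀ i ∈ S, |g i| ≤ C

section BddOn

variable {ι : Type*} {S : Set ι} {f g : ι → ℝ}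

lemma BddOn.const (c : ℝ) : BddOn S (fun _ => c) := ⟨|c|, fun _ _ => le_rfl⟩

lemma BddOn.add (hf : BddOn S f) (hg : BddOn S g) : BddOn S (fun i => f i + g i) := by
  obtain ⟨C, hC⟩ := hf
  obtain ⟨D, hD⟩ := hg
  exact ⟨C + D, fun i hi => (abs_add_le _ _).trans (add_le_add (hC i hi) (hD i hi))⟩

lemma BddOn.neg (hf : BddOn S f) : BddOn S (fun i => -f i) := by
  obtain ⟨C, hC⟩ := hf
  exact ⟨C, fun i hi => by rw [abs_neg]; exact hC i hi⟩

lemma BddOn.sub (hf : BddOn S f) (hg : BddOn S g) : BddOn S (fun i => f i - g i) := by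
  simpa only [sub_eq_add_neg] using hf.add hg.neg

lemma BddOn.mul (hf : BddOn S f) (hg : BddOn S g) : BddOn S (fun i => f i * g i) := by
  obtain ⟨C, hC⟩ := hf
  obtain ⟨D, hD⟩ := hg
  exact ⟨C * D, fun i hi => by
    rw [abs_mul]
    exact mul_le_mul (hC i hi) (hD i hi) (abs_nonneg _) ((abs_nonneg _).trans (hC i hi))⟩

lemma BddOn.pow (hf : BddOn S f) (n : ℕ) : BddOn S (fun i => f i ^ n) := by
  obtain ⟨C, hC⟩ := hf
  exact ⟨C ^ n, fun i hi => by
    rw [abs_pow]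
    exact pow_le_pow_left₀ (abs_nonneg _) (hC i hi) n⟩

lemma BddOn.exp (hf : BddOn S f) : BddOn S (fun i => Real.exp (f i)) := by
  obtain ⟨C, hC⟩ := hf
  exact ⟨Real.exp C, fun i hi => by
    rw [Real.abs_exp]
    exact Real.exp_le_exp.2 ((le_abs_self _).trans (hC i hi))⟩

/-- `BddOn.div` leaves the inverse of a denominator to be bounded. The rules for inverses mirror the
syntax of the denominators, so that long expressions can be decomposed mechanically down to their
atoms. -/
lemma BddOn.inv_const (c : ℝ) : BddOn S (fun _ => c⁻¹) := .const _

lemma BddOn.inv_mul (hf : BddOn S fun i => (f i)⁻¹) (hg : BddOn S fun i => (g i)⁻¹) :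
    BddOn S (fun i => (f i * g i)⁻¹) := by
  simpa only [_root_.mul_inv] using hf.mul hg

lemma BddOn.inv_pow (hf : BddOn S fun i => (f i)⁻¹) (n : ℕ) : BddOn S (fun i => (f i ^ n)⁻¹) := by
  simpa only [_root_.inv_pow] using hf.pow n

lemma BddOn.div (hf : BddOn S f) (hg : BddOn S fun i => (g i)⁻¹) :
    BddOn S (fun i => f i / g i) := by
  simpa only [div_eq_mul_inv] using hf.mul hg

lemma BddOn.congr (hf : BddOn S f) (h : ∀ i ∈ S, g i = f i) : BddOn S g := by
  obtain ⟨C, hC⟩ := hf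
  exact ⟨C, fun i hi => by rw [h i hi]; exact hC i hi⟩

/-- Serves for `V` and `deriv V`: on the bounded range of `φ` continuity suffices, and no growth
condition on the potential enters. -/
lemma BddOn.comp_continuous {F : ℝ → ℝ} (hF : Continuous F) (hf : BddOn S f) :
    BddOn S (fun i => F (f i)) := by
  obtain ⟨C, hC⟩ := hf
  obtain ⟨D, hD⟩ := (isCompact_Icc (a := -C) (b := C)).exists_bound_of_continuousOn hF.continuousOn
  exact ⟨D, fun i hi => hD _ (abs_le.1 (hC i hi))⟩

end BddOn

/-! ### Regular functions on a strip -/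

section Regular

variable {t₀ T : ℝ} {k : ℕ} {χ ψ : ℝ → ℝ → ℝ}

lemma uniqueDiffOn_strip : UniqueDiffOn ℝ (Ico t₀ T ×ˢ (univ : Set ℝ)) :=
  (uniqueDiffOn_Ico t₀ T).prod uniqueDiffOn_univ

lemma RegularOn.mono {l : ℕ} {I : Set ℝ} (h : RegularOn k I χ) (hl : l ≤ k) : RegularOn l I χ :=
  ⟨h.1.of_le (by exact_mod_cast hl), h.2⟩

lemma RegularOn.hasFDerivWithinAt {I : Set ℝ} (h : RegularOn k I χ) (hk : 1 ≤ k) {t : ℝ}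
    (ht : t ∈ I) (θ : ℝ) :
    HasFDerivWithinAt (fun p : ℝ × ℝ => χ p.1 p.2)
      (fderivWithin ℝ (fun p : ℝ × ℝ => χ p.1 p.2) (I ×ˢ univ) (t, θ)) (I ×ˢ univ) (t, θ) := by
  have h0 : (k : WithTop ℕ∞) ≠ 0 := by exact_mod_cast (by omega : k ≠ 0)
  exact (h.1.differentiableOn h0 (t, θ) (mk_mem_prod ht (mem_univ θ))).hasFDerivWithinAt

lemma RegularOn.hasDerivWithinAt_fst {I : Set ℝ} (h : RegularOn k I χ) (hk : 1 ≤ k) {t : ℝ}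
    (ht : t ∈ I) (θ : ℝ) : HasDerivWithinAt (fun s => χ s θ)
      (fderivWithin ℝ (fun p : ℝ × ℝ => χ p.1 p.2) (I ×ˢ univ) (t, θ) (1, 0)) I t := by
  have h1 : HasDerivWithinAt (fun s : ℝ => (s, θ)) ((1 : ℝ), (0 : ℝ)) I t :=
    (hasDerivWithinAt_id t I).prodMk (hasDerivWithinAt_const t I θ)
  exact (h.hasFDerivWithinAt hk ht θ).comp_hasDerivWithinAt t h1
    (fun s hs => mk_mem_prod hs (mem_univ _))

lemma RegularOn.hasDerivAt_snd {I : Set ℝ} (h : RegularOn k I χ) (hk : 1 ≤ k) {t : ℝ}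
    (ht : t ∈ I) (θ : ℝ) : HasDerivAt (fun x => χ t x)
      (fderivWithin ℝ (fun p : ℝ × ℝ => χ p.1 p.2) (I ×ˢ univ) (t, θ) (0, 1)) θ := by
  have h1 : HasDerivWithinAt (fun x : ℝ => (t, x)) ((0 : ℝ), (1 : ℝ)) univ θ :=
    (hasDerivWithinAt_const θ univ t).prodMk (hasDerivWithinAt_id θ univ)
  exact hasDerivWithinAt_univ.1 ((h.hasFDerivWithinAt hk ht θ).comp_hasDerivWithinAt θ h1
    (fun s _ => mk_mem_prod ht (mem_univ _)))

lemma RegularOn.hasDerivWithinAt_dt {I : Set ℝ} (h : RegularOn k I χ) (hk : 1 ≤ k) {t : ℝ}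
    (ht : t ∈ I) (θ : ℝ) : HasDerivWithinAt (fun s => χ s θ) (dt I χ t θ) I t :=
  (h.hasDerivWithinAt_fst hk ht θ).differentiableWithinAt.hasDerivWithinAt

lemma RegularOn.regularOn_dt (h : RegularOn (k + 1) (Ico t₀ T) χ) :
    RegularOn k (Ico t₀ T) (dt (Ico t₀ T) χ) := by
  refine ⟨?_, fun t ht θ => ?_⟩
  · have h1 := (h.1.fderivWithin uniqueDiffOn_strip (m := k) (by norm_cast)).clm_apply
      (contDiffOn_const (c := ((1 : ℝ), (0 : ℝ))))
    refine h1.congr fun p hp => ?_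
    exact (h.hasDerivWithinAt_fst (by omega) hp.1 p.2).derivWithin (uniqueDiffOn_Ico t₀ T _ hp.1)
  · exact derivWithin_congr (fun s hs => h.2 s hs θ) (h.2 t ht θ)

lemma RegularOn.regularOn_dθ (h : RegularOn (k + 1) (Ico t₀ T) χ) :
    RegularOn k (Ico t₀ T) (dθ χ) := by
  refine ⟨?_, fun t ht θ => ?_⟩
  · have h1 := (h.1.fderivWithin uniqueDiffOn_strip (m := k) (by norm_cast)).clm_apply
      (contDiffOn_const (c := ((0 : ℝ), (1 : ℝ))))
    refine h1.congr fun p hp => ?_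
    exact (h.hasDerivAt_snd (by omega) hp.1 p.2).deriv
  · have : (fun x => χ t (x + 2 * Real.pi)) = fun x => χ t x := funext fun x => h.2 t ht x
    rw [dθ, dθ, ← deriv_comp_add_const, this]

lemma RegularOn.add {I : Set ℝ} (h : RegularOn k I χ) (h' : RegularOn k I ψ) :
    RegularOn k I (fun t θ => χ t θ + ψ t θ) :=
  ⟨h.1.add h'.1, fun t ht θ => by simp only [h.2 t ht, h'.2 t ht]⟩

lemma RegularOn.sub {I : Set ℝ} (h : RegularOn k I χ) (h' : RegularOn k I ψ) :
    RegularOn k I (fun t θ => χ t θ - ψ t θ) :=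
  ⟨h.1.sub h'.1, fun t ht θ => by simp only [h.2 t ht, h'.2 t ht]⟩

lemma RegularOn.mul {I : Set ℝ} (h : RegularOn k I χ) (h' : RegularOn k I ψ) :
    RegularOn k I (fun t θ => χ t θ * ψ t θ) :=
  ⟨h.1.mul h'.1, fun t ht θ => by simp only [h.2 t ht, h'.2 t ht]⟩

lemma RegularOn.pow {I : Set ℝ} (h : RegularOn k I χ) (m : ℕ) :
    RegularOn k I (fun t θ => χ t θ ^ m) :=
  ⟨h.1.pow m, fun t ht θ => by simp only [h.2 t ht]⟩

lemma RegularOn.exp {I : Set ℝ} (h : RegularOn k I χ) :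
    RegularOn k I (fun t θ => Real.exp (χ t θ)) :=
  ⟨h.1.exp, fun t ht θ => by simp only [h.2 t ht]⟩

lemma RegularOn.div {I : Set ℝ} (h : RegularOn k I χ) (h' : RegularOn k I ψ)
    (h0 : ∀ t ∈ I, ∀ θ, ψ t θ ≠ 0) : RegularOn k I (fun t θ => χ t θ / ψ t θ) :=
  ⟨h.1.div h'.1 fun p hp => h0 p.1 hp.1 p.2, fun t ht θ => by simp only [h.2 t ht, h'.2 t ht]⟩

lemma RegularOn.sqrt {I : Set ℝ} (h : RegularOn k I χ) (h0 : ∀ t ∈ I, ∀ θ, 0 < χ t θ) :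
    RegularOn k I (fun t θ => √(χ t θ)) :=
  ⟨h.1.sqrt fun p hp => (h0 p.1 hp.1 p.2).ne', fun t ht θ => by simp only [h.2 t ht]⟩

lemma RegularOn.log {I : Set ℝ} (h : RegularOn k I χ) (h0 : ∀ t ∈ I, ∀ θ, 0 < χ t θ) :
    RegularOn k I (fun t θ => Real.log (χ t θ)) :=
  ⟨h.1.log fun p hp => (h0 p.1 hp.1 p.2).ne', fun t ht θ => by simp only [h.2 t ht]⟩

lemma RegularOn.const {I : Set ℝ} (c : ℝ) : RegularOn k I (fun _ _ => c) :=
  ⟨contDiffOn_const, fun _ _ _ => rfl⟩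

lemma RegularOn.time {I : Set ℝ} : RegularOn k I (fun t _ => t) :=
  ⟨contDiff_fst.contDiffOn, fun _ _ _ => rfl⟩

lemma RegularOn.neg {I : Set ℝ} (h : RegularOn k I χ) : RegularOn k I (fun t θ => -χ t θ) :=
  ⟨h.1.neg, fun t ht θ => by simp only [h.2 t ht]⟩

lemma two_pi_periodic_reduce {g : ℝ → ℝ} (hg : ∀ θ, g (θ + 2 * Real.pi) = g θ) (θ : ℝ) :
    ∃ θ' ∈ Icc 0 (2 * Real.pi), g θ = g θ' := by
  obtain ⟨y, hy, h⟩ := Function.Periodic.exists_mem_Ico₀ (f := g) hg Real.two_pi_pos θ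
  exact ⟨y, Ico_subset_Icc_self hy, h⟩

lemma RegularOn.exists_bound (h : RegularOn k (Ico t₀ T) χ) {t₂ : ℝ} (ht₂ : t₂ < T) :
    ∃ C, ∀ t ∈ Icc t₀ t₂, ∀ θ, |χ t θ| ≤ C := by
  have hsub : Icc t₀ t₂ ⊆ Ico t₀ T := fun s hs => ⟨hs.1, hs.2.trans_lt ht₂⟩
  obtain ⟨C, hC⟩ := ((isCompact_Icc (a := t₀) (b := t₂)).prod
    (isCompact_Icc (a := 0) (b := 2 * Real.pi))).exists_bound_of_continuousOn
    (h.1.continuousOn.mono (prod_mono hsub (subset_univ _)))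
  refine ⟨C, fun t ht θ => ?_⟩
  obtain ⟨θ', hθ', he⟩ := two_pi_periodic_reduce (h.2 t (hsub ht)) θ
  rw [he]
  exact hC (t, θ') ⟨ht, hθ'⟩

/-- Maximum principle for a transport operator on the circle: a bound on `∂_t χ + c ∂_θ χ` gives
a bound on the growth of `χ`. -/
lemma RegularOn.le_add_of_transport_le (h : RegularOn 1 (Ico t₀ T) χ) {t₁ : ℝ} (h₁ : t₁ < T)
    {c : ℝ → ℝ → ℝ} {C E : ℝ}
    (hC : ∀ t ∈ Icc t₀ t₁, ∀ θ, dt (Ico t₀ T) χ t θ + c t θ * dθ χ t θ ≤ C)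
    (hE : ∀ θ, χ t₀ θ ≤ E) : ∀ t ∈ Icc t₀ t₁, ∀ θ, χ t θ ≤ E + C * (t - t₀) := by
  have hsub : Icc t₀ t₁ ⊆ Ico t₀ T := fun s hs => ⟨hs.1, hs.2.trans_lt h₁⟩
  -- The slack `ε` makes the inequality at a maximum strict; it is sent to `0` at the end.
  have key : ∀ ε > 0, ∀ t ∈ Icc t₀ t₁, ∀ θ, χ t θ ≤ E + (C + ε) * (t - t₀) := by
    intro ε hε t ht θ
    have hcont : ContinuousOn (fun p : ℝ × ℝ => χ p.1 p.2 - (C + ε) * (p.1 - t₀))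
        (Icc t₀ t₁ ×ˢ Icc 0 (2 * Real.pi)) :=
      (h.1.continuousOn.mono (prod_mono hsub (subset_univ _))).sub (by fun_prop)
    obtain ⟨⟨t', θ'⟩, ⟨ht', hθ'⟩, hmax⟩ := (isCompact_Icc.prod isCompact_Icc).exists_isMaxOn
      (⟨(t, 0), ht, left_mem_Icc.2 Real.two_pi_pos.le⟩ :
        (Icc t₀ t₁ ×ˢ Icc 0 (2 * Real.pi)).Nonempty) hcont
    -- By periodicity a maximum over one period is a maximum over the whole line, so it is critical
    -- in `θ` even if it lies at an endpoint of the period.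
    have hmax' : ∀ s ∈ Icc t₀ t₁, ∀ x,
        χ s x - (C + ε) * (s - t₀) ≤ χ t' θ' - (C + ε) * (t' - t₀) := by
      intro s hs x
      obtain ⟨x', hx', he⟩ := two_pi_periodic_reduce (h.2 s (hsub hs)) x
      rw [he]
      exact hmax (a := (s, x')) ⟨hs, hx'⟩
    simp only at ht' hθ'
    suffices t' = t₀ by
      have := hmax' t ht θ
      rw [‹t' = t₀›] at this
      linarith [hE θ']
    by_contra hne
    have hlt : t₀ < t' := lt_of_le_of_ne ht'.1 (Ne.symm hne)
    -- The transport term vanishes at the maximum whatever the speed `c`, which therefore needs no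
    -- regularity.
    have hθ0 : dθ χ t' θ' = 0 := by
      refine IsLocalMax.deriv_eq_zero (Filter.Eventually.of_forall fun x => ?_)
      simpa using hmax' t' ht' x
    have hd := hC t' ht' θ'
    rw [hθ0, mul_zero, add_zero] at hd
    have hder : HasDerivAt (fun s => χ s θ' - (C + ε) * (s - t₀))
        (dt (Ico t₀ T) χ t' θ' - (C + ε) * 1) t' :=
      ((h.hasDerivWithinAt_dt le_rfl (hsub ht') θ').hasDerivAt
        (Ico_mem_nhds hlt (ht'.2.trans_lt h₁))).sub
        (((hasDerivAt_id t').sub_const t₀).const_mul (C + ε))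
    -- Left difference quotients at a maximum are nonnegative, so the time derivative is too,
    -- whereas the hypothesis makes it at most `-ε`.
    have hmono : ∀ᶠ s in nhdsWithin t' (Iio t'),
        0 ≤ slope (fun s => χ s θ' - (C + ε) * (s - t₀)) t' s := by
      filter_upwards [Ioo_mem_nhdsLT hlt] with s hs
      rw [slope_def_field]
      refine div_nonneg_of_nonpos ?_ (by linarith [hs.2])
      have := hmax' s ⟨hs.1.le, hs.2.le.trans ht'.2⟩ θ'
      simpa using this
    have h2 := ge_of_tendsto ((hasDerivAt_iff_tendsto_slope.1 hder).mono_left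
      (nhdsWithin_mono t' (s := Iio t') fun s hs => (mem_Iio.1 hs).ne)) hmono
    linarith
  intro t ht θ
  refine le_of_forall_pos_le_add fun ε hε => ?_
  -- The summand `1` avoids division by zero at `t = t₀`.
  have hp : 0 < t - t₀ + 1 := by linarith [ht.1]
  refine (key (ε / (t - t₀ + 1)) (div_pos hε hp) t ht θ).trans ?_
  have : ε / (t - t₀ + 1) * (t - t₀) ≤ ε := by
    rw [div_mul_eq_mul_div, div_le_iff₀ hp]
    nlinarith
  linarith

lemma dt_neg (I : Set ℝ) (t θ : ℝ) : dt I (fun s x => -χ s x) t θ = -dt I χ t θ :=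
  derivWithin.fun_neg

lemma dθ_neg (t θ : ℝ) : dθ (fun s x => -χ s x) t θ = -dθ χ t θ := deriv.fun_neg

lemma RegularOn.abs_le_of_transport_le (h : RegularOn 1 (Ico t₀ T) χ) {t₁ : ℝ} (h₁ : t₁ < T)
    {c : ℝ → ℝ → ℝ} {C E : ℝ}
    (hC : ∀ t ∈ Icc t₀ t₁, ∀ θ, |dt (Ico t₀ T) χ t θ + c t θ * dθ χ t θ| ≤ C)
    (hE : ∀ θ, |χ t₀ θ| ≤ E) : ∀ t ∈ Icc t₀ t₁, ∀ θ, |χ t θ| ≤ E + C * (t - t₀) := by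
  intro t ht θ
  refine abs_le'.2 ⟨h.le_add_of_transport_le h₁ (c := c)
      (fun s hs x => (le_abs_self _).trans (hC s hs x)) (fun x => (le_abs_self _).trans (hE x))
      t ht θ, h.neg.le_add_of_transport_le h₁ (c := c)
      (fun s hs x => ?_) (fun x => (neg_le_abs _).trans (hE x)) t ht θ⟩
  rw [dt_neg, dθ_neg]
  have := (neg_le_abs _).trans (hC s hs x)
  linarith

lemma RegularOn.abs_le_of_abs_dt_le (h : RegularOn 1 (Ico t₀ T) χ) {t₁ : ℝ} (h₁ : t₁ < T)
    {C E : ℝ} (hC : ∀ t ∈ Icc t₀ t₁, ∀ θ, |dt (Ico t₀ T) χ t θ| ≤ C)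
    (hE : ∀ θ, |χ t₀ θ| ≤ E) : ∀ t ∈ Icc t₀ t₁, ∀ θ, |χ t θ| ≤ E + C * (t - t₀) :=
  h.abs_le_of_transport_le h₁ (c := fun _ _ => 0) (by simpa using hC) hE

end Regular

/-! ### Ordinary differential inequalities -/

lemma abs_sub_le_of_hasDerivWithinAt {t₀ t₁ C : ℝ} {g g' : ℝ → ℝ}
    (hg : ∀ s ∈ Icc t₀ t₁, HasDerivWithinAt g (g' s) (Icc t₀ t₁) s)
    (hC : ∀ s ∈ Icc t₀ t₁, |g' s| ≤ C) {t : ℝ} (ht : t ∈ Icc t₀ t₁) :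
    |g t - g t₀| ≤ C * (t - t₀) := by
  have := (convex_Icc t₀ t₁).norm_image_sub_le_of_norm_hasDerivWithin_le hg hC
    (left_mem_Icc.2 (ht.1.trans ht.2)) ht
  simpa [Real.norm_eq_abs, abs_of_nonneg (sub_nonneg.2 ht.1)] using this

/-- Short time control of a pair of functions whose growth is at most that of
`exp (ℓ + 2 τ)`. -/
lemma exists_time_pair_bound (C N : ℝ) : ∃ δ > 0, ∀ (t₀ t₁ : ℝ), t₁ ≤ t₀ + δ →
    ∀ (l τ l' τ' : ℝ → ℝ),
    (∀ s ∈ Icc t₀ t₁, HasDerivWithinAt l (l' s) (Icc t₀ t₁) s) →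
    (∀ s ∈ Icc t₀ t₁, HasDerivWithinAt τ (τ' s) (Icc t₀ t₁) s) →
    |l t₀| ≤ N → |τ t₀| ≤ N →
    (∀ s ∈ Icc t₀ t₁, |l' s| ≤ C * (1 + Real.exp (l s + 2 * τ s))) →
    (∀ s ∈ Icc t₀ t₁, |τ' s| ≤ C * (1 + Real.exp (l s + 2 * τ s))) →
    ∀ s ∈ Icc t₀ t₁, |l s| ≤ N + 1 ∧ |τ s| ≤ N + 1 := by
  -- Put `p = l + 2τ` and `q = log (1 + e^{-p})`. Since `|p'| ≤ 3|C|(1 + e^p)` and `e^{-p}(1 + e^p)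
  -- = 1 + e^{-p}`, one gets `|q'| ≤ 3|C|`. The initial bound `p ≤ 3N` gives `q ≥ G` at the start.
  -- As long as `q ≥ G/2`, one has `e^{-p} ≥ z`, so the nonlinear factor `e^p` is at most `z⁻¹` and
  -- both rates are at most `B`.
  set G := Real.log (1 + Real.exp (-(3 * N))) with hG
  have hGpos : 0 < G := Real.log_pos (by linarith [Real.exp_pos (-(3 * N))])
  set z := Real.exp (G / 2) - 1 with hz
  have hzpos : 0 < z := by linarith [Real.add_one_lt_exp (by linarith : G / 2 ≠ 0)]
  set B := |C| * (1 + z⁻¹) with hB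
  have hBnn : 0 ≤ B := by positivity
  -- The first time keeps `q` above `G/2`; the second keeps the change of `l` and of `τ` below `1`.
  -- The added ones keep the denominators positive.
  refine ⟨min (G / 2 / (3 * |C| + 1)) (1 / (B + 1)), by positivity, ?_⟩
  intro t₀ t₁ h₁ l τ l' τ' hl hτ hl0 hτ0 hl' hτ' s hs
  have hsδ : ∀ r ∈ Icc t₀ t₁, r - t₀ ≤ G / 2 / (3 * |C| + 1) ∧ r - t₀ ≤ 1 / (B + 1) := by
    intro r hr
    have : r - t₀ ≤ min (G / 2 / (3 * |C| + 1)) (1 / (B + 1)) := by linarith [hr.2]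
    exact le_min_iff.1 this
  have hexp : ∀ r ∈ Icc t₀ t₁, Real.exp (l r + 2 * τ r) ≤ z⁻¹ := by
    intro r hr
    have hd : ∀ x ∈ Icc t₀ t₁, HasDerivWithinAt
        (fun y => Real.log (1 + Real.exp (-(l y + 2 * τ y))))
        (Real.exp (-(l x + 2 * τ x)) * (-(l' x + 2 * τ' x)) / (1 + Real.exp (-(l x + 2 * τ x))))
        (Icc t₀ t₁) x := fun x hx =>
      ((((hl x hx).add ((hτ x hx).const_mul 2)).neg.exp).const_add 1).log
        (by positivity)
    have hb : ∀ x ∈ Icc t₀ t₁, |Real.exp (-(l x + 2 * τ x)) * (-(l' x + 2 * τ' x)) /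
        (1 + Real.exp (-(l x + 2 * τ x)))| ≤ 3 * |C| := by
      intro x hx
      set p := l x + 2 * τ x with hp
      have h1 := hl' x hx
      have h2 := hτ' x hx
      have h3 : |-(l' x + 2 * τ' x)| ≤ 3 * |C| * (1 + Real.exp p) := by
        rw [abs_neg]
        refine (abs_add_le _ _).trans ?_
        rw [abs_mul, abs_two]
        have : C * (1 + Real.exp p) ≤ |C| * (1 + Real.exp p) := by gcongr; exact le_abs_self C
        linarith
      rw [abs_div, abs_mul, Real.abs_exp, abs_of_pos (by positivity : 0 < 1 + Real.exp (-p)),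
        div_le_iff₀ (by positivity)]
      calc Real.exp (-p) * |-(l' x + 2 * τ' x)|
          ≤ Real.exp (-p) * (3 * |C| * (1 + Real.exp p)) := by gcongr
        _ = 3 * |C| * (Real.exp (-p) + Real.exp (-p) * Real.exp p) := by ring
        _ = 3 * |C| * (1 + Real.exp (-p)) := by
          rw [← Real.exp_add, neg_add_cancel, Real.exp_zero]; ring
    have h1 := abs_sub_le_of_hasDerivWithinAt hd hb hr
    have h2 : 3 * |C| * (r - t₀) ≤ G / 2 := by
      have h3 := (hsδ r hr).1
      rw [le_div_iff₀ (by positivity)] at h3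
      linarith [hr.1]
    have h4 : G ≤ Real.log (1 + Real.exp (-(l t₀ + 2 * τ t₀))) := by
      refine Real.log_le_log (by positivity) ?_
      gcongr
      linarith [le_abs_self (l t₀), le_abs_self (τ t₀)]
    have h5 : G / 2 ≤ Real.log (1 + Real.exp (-(l r + 2 * τ r))) := by
      linarith [(abs_le.1 h1).1]
    rw [Real.le_log_iff_exp_le (by positivity)] at h5
    rw [← neg_neg (l r + 2 * τ r), Real.exp_neg (-(l r + 2 * τ r))]
    exact inv_anti₀ hzpos (by linarith)
  have hB' : ∀ r ∈ Icc t₀ t₁, C * (1 + Real.exp (l r + 2 * τ r)) ≤ B := fun r hr => by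
    refine mul_le_mul (le_abs_self C) ?_ (by positivity) (abs_nonneg C)
    linarith [hexp r hr]
  have hBs : B * (s - t₀) ≤ 1 := by
    have h3 := (hsδ s hs).2
    rw [le_div_iff₀ (by positivity)] at h3
    linarith [hs.1]
  have h1 := abs_sub_le_of_hasDerivWithinAt hl (fun r hr => (hl' r hr).trans (hB' r hr)) hs
  have h2 := abs_sub_le_of_hasDerivWithinAt hτ (fun r hr => (hτ' r hr).trans (hB' r hr)) hs
  constructor
  · linarith [abs_sub_abs_le_abs_sub (l s) (l t₀)]
  · linarith [abs_sub_abs_le_abs_sub (τ s) (τ t₀)]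

/-- Short time control of a solution of a differential inequality with linear growth. -/
lemma exists_time_gronwall {E : Type*} [NormedAddCommGroup E] [NormedSpace ℝ E] (C R : ℝ) :
    ∃ δ > 0, ∀ (t₀ t₁ : ℝ), t₀ ≤ t₁ → t₁ ≤ t₀ + δ → ∀ (W W' : ℝ → E),
    (∀ s ∈ Icc t₀ t₁, HasDerivWithinAt W (W' s) (Icc t₀ t₁) s) → ‖W t₀‖ ≤ R →
    (∀ s ∈ Icc t₀ t₁, ‖W' s‖ ≤ C * (1 + ‖W s‖)) → ‖W t₁‖ ≤ R + 1 := by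
  -- The Grönwall bound is continuous in time and equals `R` at time `0`, so it stays below `R + 1`
  -- for a while; no explicit formula is needed.
  have hcont : ContinuousAt (gronwallBound R C C) 0 :=
    (hasDerivAt_gronwallBound R C C 0).continuousAt
  have hev := hcont.eventually (eventually_lt_nhds
    (by rw [gronwallBound_x0]; linarith : gronwallBound R C C 0 < R + 1))
  obtain ⟨δ, hδ, hball⟩ := Metric.eventually_nhds_iff.1 hev
  refine ⟨δ / 2, by positivity, fun t₀ t₁ h₀ h₁ W W' hW hR hW' => ?_⟩
  have hg := norm_le_gronwallBound_of_norm_deriv_right_le (f := W) (f' := W') (δ := R) (K := C)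
    (ε := C) (fun s hs => (hW s hs).continuousWithinAt)
    (fun s hs => (hW s (Ico_subset_Icc_self hs)).mono_of_mem_nhdsWithin
      (Icc_mem_nhdsGE_of_mem hs)) hR
    (fun s hs => (hW' s (Ico_subset_Icc_self hs)).trans (by linarith)) t₁ (right_mem_Icc.2 h₀)
  refine hg.trans (hball ?_).le
  rw [Real.dist_eq, sub_zero, abs_of_nonneg (by linarith)]
  linarith

lemma BddOn.of_sq {ι : Type*} {S : Set ι} {f : ι → ℝ} (h : BddOn S (fun i => f i ^ 2)) :
    BddOn S f := by
  obtain ⟨C, hC⟩ := h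
  -- For `C ≥ 0` one has `C ≤ (C + 1)²`, so no square root is needed.
  refine ⟨C + 1, fun i hi => ?_⟩
  have h1 := (le_abs_self _).trans (hC i hi)
  have h2 : (0 : ℝ) ≤ C := (sq_nonneg _).trans h1
  exact abs_le_of_sq_le_sq (by nlinarith) (by linarith)

lemma BddOn.of_nonneg_le {ι : Type*} {S : Set ι} {f g : ι → ℝ} (h : BddOn S g)
    (h0 : ∀ i ∈ S, 0 ≤ f i) (hfg : ∀ i ∈ S, f i ≤ g i) : BddOn S f := by
  obtain ⟨C, hC⟩ := h
  exact ⟨C, fun i hi => by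
    rw [abs_of_nonneg (h0 i hi)]
    exact (hfg i hi).trans ((le_abs_self _).trans (hC i hi))⟩

/-! ### Pointwise bounds for a set of fields -/

/-- Bounds for a distribution function and its momentum support at a point. -/
structure DistBound (M : ℝ) (f : ℝ → ℝ → Mom → ℝ) (t θ : ℝ) : Prop where
  val : ∀ v, |f t θ v| ≤ M
  supp : ∀ v, f t θ v ≠ 0 → ‖v‖ ≤ M

/-- Bounds for the quantities that obey transport equations along null paths. -/
structure NullBound (I : Set ℝ) (M : ℝ) (u : Fields) (t θ : ℝ) : Prop where
  α_pos : 0 < u.α t θ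
  Υ_add : |u.Υ I t θ + u.Υx I t θ| ≤ M
  Υ_sub : |u.Υ I t θ - u.Υx I t θ| ≤ M
  φ_add : |u.dς I u.φ t θ| ≤ M
  φ_sub : |u.dξ I u.φ t θ| ≤ M

/-- Bounds for the fields other than `α, τ, G, H`. -/
structure ValueBound (M : ℝ) (u : Fields) (t θ : ℝ) : Prop where
  μ : |u.μ t θ| ≤ M
  A : |u.A t θ| ≤ M
  φ : |u.φ t θ| ≤ M
  J : |u.J t θ| ≤ M
  K : |u.K t θ| ≤ M

/-- Bounds for `log α` and `τ`. -/
structure MetricBound (M : ℝ) (u : Fields) (t θ : ℝ) : Prop where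
  α : |Real.log (u.α t θ)| ≤ M
  τ : |u.τ t θ| ≤ M

/-- Bounds for the shifts `G`, `H`. -/
structure ShiftBound (M : ℝ) (u : Fields) (t θ : ℝ) : Prop where
  G : |u.G t θ| ≤ M
  H : |u.H t θ| ≤ M

/-- Bounds for all fields and for the null derivatives of `μ, A, φ`. -/
structure FieldBound (I : Set ℝ) (M : ℝ) (u : Fields) (t θ : ℝ) : Prop where
  dist : DistBound M u.f t θ
  null : NullBound I M u t θ
  value : ValueBound M u t θ
  metric : MetricBound M u t θ
  shift : ShiftBound M u t θ

/-- Bounds for the derivatives of `α` and `τ` that the constraint equations control. -/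
structure RateBound (I : Set ℝ) (M : ℝ) (u : Fields) (t θ : ℝ) : Prop where
  α_t : |dt I u.α t θ / u.α t θ| ≤ M
  τ_t : |dt I u.τ t θ| ≤ M
  β_θ : |dθ u.τ t θ + dθ u.α t θ / (2 * u.α t θ)| ≤ M

section Families

variable {ι : Type*} {S : Set ι} {I : Set ℝ} {M t₀ t₂ : ℝ} {x : ι → Fields} {t θ : ι → ℝ}

lemma bddOn_time (ht₀ : 0 < t₀) (ht : ∀ i ∈ S, t i ∈ Icc t₀ t₂) :
    BddOn S t ∧ BddOn S (fun i => (t i)⁻¹) := by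
  refine ⟨⟨t₂, fun i hi => ?_⟩, ⟨t₀⁻¹, fun i hi => ?_⟩⟩
  · rw [abs_of_nonneg (ht₀.le.trans (ht i hi).1)]
    exact (ht i hi).2
  · rw [abs_of_nonneg (inv_nonneg.2 (ht₀.le.trans (ht i hi).1))]
    exact inv_anti₀ ht₀ (ht i hi).1

/-- The support bound reduces the integral to a fixed ball of finite volume, on which the continuous
weight is bounded. -/
lemma bddOn_moment {g : ι → ℝ → ℝ → Mom → ℝ} {w : Mom → ℝ} (hw : Continuous w)
    (h : ∀ i ∈ S, DistBound M (g i) (t i) (θ i)) :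
    BddOn S (fun i => moment (g i) w (t i) (θ i)) := by
  refine BddOn.mul (.const _) ?_
  obtain ⟨D, hD⟩ := (isCompact_closedBall (0 : Mom) M).exists_bound_of_continuousOn hw.continuousOn
  refine ⟨D * M * volume.real (Metric.closedBall (0 : Mom) M), fun i hi => ?_⟩
  have hz : ∀ v ∉ Metric.closedBall (0 : Mom) M, w v * g i (t i) (θ i) v = 0 := by
    intro v hv
    rw [not_imp_comm.1 ((h i hi).supp v) (by simpa using hv), mul_zero]
  beta_reduce
  rw [← setIntegral_eq_integral_of_forall_compl_eq_zero hz, ← Real.norm_eq_abs]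
  refine norm_setIntegral_le_of_norm_le_const measure_closedBall_lt_top fun v hv => ?_
  rw [norm_mul]
  exact mul_le_mul (hD v hv) ((h i hi).val v) (norm_nonneg _) ((norm_nonneg _).trans (hD v hv))

lemma energy_pos (v : Mom) : 0 < energy v := Real.sqrt_pos.2 (by positivity)

lemma continuous_energy : Continuous energy := by
  unfold energy
  fun_prop

/-- The moments in the energy-momentum tensor of a bounded family are bounded. -/
lemma bddOn_moments {g : ι → ℝ → ℝ → Mom → ℝ} (h : ∀ i ∈ S, DistBound M (g i) (t i) (θ i)) :
    BddOn S (fun i => moment (g i) energy (t i) (θ i)) ∧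
    BddOn S (fun i => moment (g i) (fun v => v 0) (t i) (θ i)) ∧
    BddOn S (fun i => moment (g i) (fun v => v 1) (t i) (θ i)) ∧
    BddOn S (fun i => moment (g i) (fun v => v 2) (t i) (θ i)) ∧
    BddOn S (fun i => moment (g i) (fun v => v 0 ^ 2 / energy v) (t i) (θ i)) ∧
    BddOn S (fun i => moment (g i) (fun v => v 1 ^ 2 / energy v) (t i) (θ i)) ∧
    BddOn S (fun i => moment (g i) (fun v => v 2 ^ 2 / energy v) (t i) (θ i)) ∧
    BddOn S (fun i => moment (g i) (fun v => v 0 * v 1 / energy v) (t i) (θ i)) ∧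
    BddOn S (fun i => moment (g i) (fun v => v 0 * v 2 / energy v) (t i) (θ i)) ∧
    BddOn S (fun i => moment (g i) (fun v => v 1 * v 2 / energy v) (t i) (θ i)) := by
  have hc := continuous_energy
  have h0 : ∀ v, energy v ≠ 0 := fun v => (energy_pos v).ne'
  refine ⟨?_, ?_, ?_, ?_, ?_, ?_, ?_, ?_, ?_, ?_⟩ <;>
    exact bddOn_moment (by fun_prop (disch := assumption)) h

/-- Half the sum of the two null quantities is `Υ`, and `Υ` is a sum of four nonnegative terms, each
thus at most `M`. -/
lemma Υ_nonneg_terms {u : Fields} {s y : ℝ} (h : NullBound I M u s y) :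
    dt I u.μ s y ^ 2 ≤ M ∧ u.α s y * dθ u.μ s y ^ 2 ≤ M ∧
    Real.exp (4 * u.μ s y) / (4 * s ^ 2) * dt I u.A s y ^ 2 ≤ M ∧
    Real.exp (4 * u.μ s y) / (4 * s ^ 2) * (u.α s y * dθ u.A s y ^ 2) ≤ M := by
  have h1 : u.Υ I s y ≤ M := by linarith [(abs_le.1 h.Υ_add).2, (abs_le.1 h.Υ_sub).2]
  have hα := h.α_pos
  rw [Fields.Υ, mul_add] at h1
  have e1 : 0 ≤ dt I u.μ s y ^ 2 := by positivity
  have e2 : 0 ≤ u.α s y * dθ u.μ s y ^ 2 := by positivity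
  have e3 : 0 ≤ Real.exp (4 * u.μ s y) / (4 * s ^ 2) * dt I u.A s y ^ 2 := by positivity
  have e4 : 0 ≤ Real.exp (4 * u.μ s y) / (4 * s ^ 2) * (u.α s y * dθ u.A s y ^ 2) := by
    positivity
  exact ⟨by linarith, by linarith, by linarith, by linarith⟩

/-- Here `μ_t²` occurs in `Υ` with weight one and `φ_t` is the mean of `φ_ς` and `φ_ξ`. Hence these
bounds are available before `μ` and `α` themselves are bounded. -/
lemma bddOn_dt_μ_φ (h : ∀ i ∈ S, NullBound I M (x i) (t i) (θ i)) :
    BddOn S (fun i => dt I (x i).μ (t i) (θ i)) ∧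
    BddOn S (fun i => dt I (x i).φ (t i) (θ i)) := by
  refine ⟨.of_sq ⟨M, fun i hi => ?_⟩, ⟨M, fun i hi => ?_⟩⟩
  · rw [abs_of_nonneg (sq_nonneg _)]
    exact (Υ_nonneg_terms (h i hi)).1
  · have h1 := abs_le.1 (h i hi).φ_add
    have h2 := abs_le.1 (h i hi).φ_sub
    rw [Fields.dς] at h1
    rw [Fields.dξ] at h2
    exact abs_le.2 ⟨by linarith, by linarith⟩

/-- Removing the weight `e^{4μ} / (4t²)` of `A_t²` in `Υ` requires a bound on `μ`, so `μ` has to be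
treated before `A`. -/
lemma bddOn_dt_A (ht₀ : 0 < t₀) (ht : ∀ i ∈ S, t i ∈ Icc t₀ t₂)
    (h : ∀ i ∈ S, NullBound I M (x i) (t i) (θ i))
    (hμ : ∀ i ∈ S, |(x i).μ (t i) (θ i)| ≤ M) :
    BddOn S (fun i => dt I (x i).A (t i) (θ i)) := by
  obtain ⟨h1, -⟩ := bddOn_time ht₀ ht
  have h2 : BddOn S (fun i => (x i).μ (t i) (θ i)) := ⟨M, hμ⟩
  have h3 : BddOn S (fun i => Real.exp (-4 * (x i).μ (t i) (θ i)) * (4 * t i ^ 2) * M) :=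
    ((((BddOn.const _).mul h2).exp.mul ((BddOn.const _).mul (h1.pow 2))).mul (.const _))
  refine (h3.of_nonneg_le (fun i _ => sq_nonneg _) fun i hi => ?_).of_sq
  have h4 := (Υ_nonneg_terms (h i hi)).2.2.1
  have hpos := ht₀.trans_le (ht i hi).1
  rw [neg_mul, Real.exp_neg, ← div_eq_inv_mul, ← mul_comm M, ← mul_div_assoc]
  rw [div_mul_eq_mul_div, div_le_iff₀ (by positivity)] at h4
  rw [le_div_iff₀ (Real.exp_pos _)]
  linarith

lemma bddOn_α (hα : ∀ i ∈ S, 0 < (x i).α (t i) (θ i))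
    (h : ∀ i ∈ S, MetricBound M (x i) (t i) (θ i)) :
    BddOn S (fun i => (x i).α (t i) (θ i)) ∧ BddOn S (fun i => ((x i).α (t i) (θ i))⁻¹) ∧
    BddOn S (fun i => √((x i).α (t i) (θ i))) ∧
    BddOn S (fun i => (√((x i).α (t i) (θ i)))⁻¹) := by
  have hl : BddOn S (fun i => Real.log ((x i).α (t i) (θ i))) := ⟨M, fun i hi => (h i hi).α⟩
  have h1 : BddOn S (fun i => (x i).α (t i) (θ i)) :=
    hl.exp.congr fun i hi => (Real.exp_log (hα i hi)).symm
  have h2 : BddOn S (fun i => ((x i).α (t i) (θ i))⁻¹) :=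
    hl.neg.exp.congr fun i hi => by rw [Real.exp_neg, Real.exp_log (hα i hi)]
  refine ⟨h1, h2, (h1.congr fun i hi => Real.sq_sqrt (hα i hi).le).of_sq,
    (h2.congr fun i hi => ?_).of_sq⟩
  rw [inv_pow, Real.sq_sqrt (hα i hi).le]

/-- The spatial derivatives are controlled only with factors `α` or `√α`; the lower bound on `α`
implied by the bound on `log α` removes them. -/
lemma bddOn_dθ (ht₀ : 0 < t₀) (ht : ∀ i ∈ S, t i ∈ Icc t₀ t₂)
    (h : ∀ i ∈ S, NullBound I M (x i) (t i) (θ i))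
    (hμ : ∀ i ∈ S, |(x i).μ (t i) (θ i)| ≤ M)
    (hα : ∀ i ∈ S, MetricBound M (x i) (t i) (θ i)) :
    BddOn S (fun i => dθ (x i).μ (t i) (θ i)) ∧ BddOn S (fun i => dθ (x i).A (t i) (θ i)) ∧
    BddOn S (fun i => dθ (x i).φ (t i) (θ i)) := by
  obtain ⟨h1, -⟩ := bddOn_time ht₀ ht
  obtain ⟨-, a2, -, a4⟩ := bddOn_α (fun i hi => (h i hi).α_pos) hα
  have h2 : BddOn S (fun i => (x i).μ (t i) (θ i)) := ⟨M, hμ⟩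
  refine ⟨?_, ?_, ?_⟩
  · refine ((a2.mul (.const M)).of_nonneg_le (fun i _ => sq_nonneg _) fun i hi => ?_).of_sq
    have h4 := (Υ_nonneg_terms (h i hi)).2.1
    rw [← div_eq_inv_mul, le_div_iff₀ (h i hi).α_pos]
    linarith
  · have h3 : BddOn S (fun i => ((x i).α (t i) (θ i))⁻¹ *
        (Real.exp (-4 * (x i).μ (t i) (θ i)) * (4 * t i ^ 2) * M)) :=
      a2.mul (((BddOn.const _).mul h2).exp.mul ((BddOn.const _).mul (h1.pow 2)) |>.mul (.const _))
    refine (h3.of_nonneg_le (fun i _ => sq_nonneg _) fun i hi => ?_).of_sq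
    have h4 := (Υ_nonneg_terms (h i hi)).2.2.2
    have hpos := ht₀.trans_le (ht i hi).1
    rw [← div_eq_inv_mul, le_div_iff₀ (h i hi).α_pos, neg_mul, Real.exp_neg, mul_assoc,
      ← div_eq_inv_mul]
    rw [div_mul_eq_mul_div, div_le_iff₀ (by positivity)] at h4
    rw [le_div_iff₀ (Real.exp_pos _)]
    linarith
  · have h3 : BddOn S (fun i => (x i).dς I (x i).φ (t i) (θ i)) := ⟨M, fun i hi => (h i hi).φ_add⟩
    have h4 : BddOn S (fun i => (x i).dξ I (x i).φ (t i) (θ i)) := ⟨M, fun i hi => (h i hi).φ_sub⟩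
    refine (a4.mul ((h3.sub h4).mul (.const (1 / 2)))).congr fun i hi => ?_
    have := (Real.sqrt_pos.2 (h i hi).α_pos).ne'
    rw [Fields.dς, Fields.dξ]
    field_simp
    ring

/-- The elementary quantities of a bounded family of fields are bounded. -/
lemma bddOn_atoms (ht₀ : 0 < t₀) (ht : ∀ i ∈ S, t i ∈ Icc t₀ t₂)
    (h : ∀ i ∈ S, NullBound I M (x i) (t i) (θ i))
    (hv : ∀ i ∈ S, ValueBound M (x i) (t i) (θ i))
    (hα : ∀ i ∈ S, MetricBound M (x i) (t i) (θ i)) :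
    (BddOn S (fun i => (x i).α (t i) (θ i)) ∧ BddOn S (fun i => ((x i).α (t i) (θ i))⁻¹) ∧
    BddOn S (fun i => √((x i).α (t i) (θ i))) ∧
    BddOn S (fun i => (√((x i).α (t i) (θ i)))⁻¹) ∧
    BddOn S (fun i => Real.log ((x i).α (t i) (θ i)))) ∧
    (BddOn S (fun i => (x i).τ (t i) (θ i)) ∧ BddOn S (fun i => (x i).μ (t i) (θ i)) ∧
    BddOn S (fun i => (x i).A (t i) (θ i)) ∧ BddOn S (fun i => (x i).φ (t i) (θ i)) ∧
    BddOn S (fun i => (x i).J (t i) (θ i)) ∧ BddOn S (fun i => (x i).K (t i) (θ i))) ∧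
    (BddOn S (fun i => dt I (x i).μ (t i) (θ i)) ∧ BddOn S (fun i => dt I (x i).A (t i) (θ i)) ∧
    BddOn S (fun i => dt I (x i).φ (t i) (θ i))) ∧
    (BddOn S (fun i => dθ (x i).μ (t i) (θ i)) ∧ BddOn S (fun i => dθ (x i).A (t i) (θ i)) ∧
    BddOn S (fun i => dθ (x i).φ (t i) (θ i))) := by
  have hμ := fun i hi => (hv i hi).μ
  obtain ⟨a1, a2, a3, a4⟩ := bddOn_α (fun i hi => (h i hi).α_pos) hα
  exact ⟨⟨a1, a2, a3, a4, M, fun i hi => (hα i hi).α⟩,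
    ⟨⟨M, fun i hi => (hα i hi).τ⟩, ⟨M, hμ⟩, ⟨M, fun i hi => (hv i hi).A⟩,
      ⟨M, fun i hi => (hv i hi).φ⟩, ⟨M, fun i hi => (hv i hi).J⟩, ⟨M, fun i hi => (hv i hi).K⟩⟩,
    ⟨(bddOn_dt_μ_φ h).1, bddOn_dt_A ht₀ ht h hμ, (bddOn_dt_μ_φ h).2⟩,
    bddOn_dθ ht₀ ht h hμ hα⟩

end Families

/-! ### Bounds for the right-hand sides of the equations -/

/-- Two consecutive iterates at a point of phase space. -/
structure Sample where
  u : Fields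
  w : Fields
  t : ℝ
  θ : ℝ
  v : Mom

section Samples

variable {S : Set Sample} {I : Set ℝ} {V : ℝ → ℝ} {M M' t₀ t₂ : ℝ}

lemma IsPotential.continuous_deriv (hV : IsPotential V) : Continuous (deriv V) :=
  hV.smooth.continuous_deriv (by exact_mod_cast le_top)

/-- Bounds for the sources in the equations along null paths and in the equations for the twist
quantities. -/
lemma bddOn_sources (hV : IsPotential V) (ht₀ : 0 < t₀) (ht : ∀ i ∈ S, i.t ∈ Icc t₀ t₂)
    (hu : ∀ i ∈ S, FieldBound I M i.u i.t i.θ) (hr : ∀ i ∈ S, RateBound I M' i.u i.t i.θ)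
    (hf : ∀ i ∈ S, DistBound M i.w.f i.t i.θ) :
    (BddOn S (fun i : Sample =>
      (dt I i.u.α i.t i.θ / (2 * i.u.α i.t i.θ) - 1 / (2 * i.t) + i.u.shift i.t i.θ) *
        i.u.dς I i.u.φ i.t i.θ - (1 / (2 * i.t) + i.u.shift i.t i.θ) * i.u.dξ I i.u.φ i.t i.θ
      - Real.exp (2 * i.u.β i.t i.θ - 2 * i.u.μ i.t i.θ) * deriv V (i.u.φ i.t i.θ)) ∧
    BddOn S (fun i : Sample =>
      (dt I i.u.α i.t i.θ / (2 * i.u.α i.t i.θ) - 1 / (2 * i.t) - i.u.shift i.t i.θ) *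
        i.u.dξ I i.u.φ i.t i.θ - (1 / (2 * i.t) - i.u.shift i.t i.θ) * i.u.dς I i.u.φ i.t i.θ
      - Real.exp (2 * i.u.β i.t i.θ - 2 * i.u.μ i.t i.θ) * deriv V (i.u.φ i.t i.θ))) ∧
    (BddOn S (fun i : Sample =>
      dt I i.u.α i.t i.θ / i.u.α i.t i.θ * (i.u.Υ I i.t i.θ + i.u.Υx I i.t i.θ)
      - i.u.Υx I i.t i.θ / i.t
      - 2 / i.t * (dt I i.u.μ i.t i.θ ^ 2
        + Real.exp (4 * i.u.μ i.t i.θ) / (4 * i.t ^ 2) * i.u.α i.t i.θ * dθ i.u.A i.t i.θ ^ 2)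
      + 2 * i.u.dς I i.u.μ i.t i.θ * i.u.sourceμ I V i.w.f i.t i.θ
      + Real.exp (4 * i.u.μ i.t i.θ) / (2 * i.t ^ 2) * i.u.dς I i.u.A i.t i.θ *
        i.u.sourceA i.w.f i.t i.θ) ∧
    BddOn S (fun i : Sample =>
      dt I i.u.α i.t i.θ / i.u.α i.t i.θ * (i.u.Υ I i.t i.θ - i.u.Υx I i.t i.θ)
      + i.u.Υx I i.t i.θ / i.t
      - 2 / i.t * (dt I i.u.μ i.t i.θ ^ 2
        + Real.exp (4 * i.u.μ i.t i.θ) / (4 * i.t ^ 2) * i.u.α i.t i.θ * dθ i.u.A i.t i.θ ^ 2)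
      + 2 * i.u.dξ I i.u.μ i.t i.θ * i.u.sourceμ I V i.w.f i.t i.θ
      + Real.exp (4 * i.u.μ i.t i.θ) / (2 * i.t ^ 2) * i.u.dξ I i.u.A i.t i.θ *
        i.u.sourceA i.w.f i.t i.θ)) ∧
    BddOn S (fun i : Sample =>
      -2 * i.t * √(i.u.α i.t i.θ) * Real.exp (i.u.τ i.t i.θ) * S₁₂ i.u.f i.t i.θ) ∧
    BddOn S (fun i : Sample => -2 * i.t * √(i.u.α i.t i.θ) * Real.exp (i.u.τ i.t i.θ) *
      (i.u.A i.t i.θ * S₁₂ i.u.f i.t i.θ +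
        i.t * Real.exp (-2 * i.u.μ i.t i.θ) * S₁₃ i.u.f i.t i.θ)) := by
  obtain ⟨s1, s2⟩ := bddOn_time ht₀ ht
  obtain ⟨⟨a1, a2, a3, a4, a5⟩, ⟨b1, b2, b3, b4, b5, b6⟩, ⟨c1, c2, c3⟩, ⟨d1, d2, d3⟩⟩ :=
    bddOn_atoms (x := Sample.u) (t := Sample.t) (θ := Sample.θ) ht₀ ht
      (fun i hi => (hu i hi).null) (fun i hi => (hu i hi).value) (fun i hi => (hu i hi).metric)
  obtain ⟨m1, m2, m3, m4, m5, m6, m7, m8, m9, m10⟩ :=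
    bddOn_moments (g := fun i => i.w.f) (t := Sample.t) (θ := Sample.θ) hf
  obtain ⟨-, -, -, -, -, -, -, n8, n9, -⟩ := bddOn_moments (g := fun i => i.u.f)
    (t := Sample.t) (θ := Sample.θ) fun i hi => (hu i hi).dist
  have r1 : BddOn S (fun i => dt I i.u.α i.t i.θ / i.u.α i.t i.θ) := ⟨M', fun i hi => (hr i hi).α_t⟩
  -- The quotient must be available as one atom: `α_t` alone is not among the bounded quantities,
  -- and `assumption` is tried before quotients are split.
  have r2 : BddOn S (fun i => dt I i.u.α i.t i.θ / (2 * i.u.α i.t i.θ)) :=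
    (r1.mul (.const (1 / 2))).congr fun i hi => by ring
  have g1 : BddOn S (fun i => i.u.G i.t i.θ) := ⟨M, fun i hi => (hu i hi).shift.G⟩
  have g2 : BddOn S (fun i => i.u.H i.t i.θ) := ⟨M, fun i hi => (hu i hi).shift.H⟩
  have v1 := b4.comp_continuous hV.smooth.continuous
  have v2 := b4.comp_continuous hV.continuous_deriv
  refine ⟨⟨?_, ?_⟩, ⟨?_, ?_⟩, ?_, ?_⟩ <;>
  · simp only [Fields.shift, Fields.dς, Fields.dξ, Fields.β, Fields.Υ, Fields.Υx, Fields.sourceμ,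
      Fields.sourceA, Fields.ρ, Fields.P₁, Fields.P₂, Fields.P₃, Fields.kin, Fields.lag, S₁₂, S₁₃,
      S₂₃]
    repeat' with_reducible first
      | assumption | exact BddOn.const _ | apply BddOn.add | apply BddOn.sub | apply BddOn.neg
      | apply BddOn.mul | apply BddOn.div | apply BddOn.pow
      | apply BddOn.exp | exact BddOn.inv_const _ | apply BddOn.inv_mul | apply BddOn.inv_pow

/-- Bounds for the terms of the constraint equations that do not contain `Υ`. -/
lemma bddOn_constraint_terms (hV : IsPotential V) (ht₀ : 0 < t₀)
    (ht : ∀ i ∈ S, i.t ∈ Icc t₀ t₂) (hu : ∀ i ∈ S, FieldBound I M i.u i.t i.θ)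
    (hf : ∀ i ∈ S, DistBound M i.w.f i.t i.θ) (hw : ∀ i ∈ S, ValueBound M i.w i.t i.θ) :
    BddOn S (fun i => Real.exp (-4 * i.w.μ i.t i.θ) / (4 * i.t) * i.w.J i.t i.θ ^ 2
      + 1 / (4 * i.t ^ 3) * (i.w.K i.t i.θ - i.w.A i.t i.θ * i.w.J i.t i.θ) ^ 2
      + i.t * Real.exp (-2 * i.w.μ i.t i.θ) * i.u.ρ I V i.w.f i.t i.θ) ∧
    BddOn S (fun i => -(Real.exp (-4 * i.w.μ i.t i.θ) / i.t * i.w.J i.t i.θ ^ 2)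
      - 1 / i.t ^ 3 * (i.w.K i.t i.θ - i.w.A i.t i.θ * i.w.J i.t i.θ) ^ 2
      - 2 * i.t * Real.exp (-2 * i.w.μ i.t i.θ) *
        (i.u.ρ I V i.w.f i.t i.θ - i.u.P₁ I V i.w.f i.t i.θ)) ∧
    BddOn S (fun i => i.t * Real.exp (-2 * i.w.μ i.t i.θ) * i.u.ρ₁ I i.w.f i.t i.θ) := by
  obtain ⟨s1, s2⟩ := bddOn_time ht₀ ht
  obtain ⟨⟨a1, a2, a3, a4, a5⟩, ⟨b1, b2, b3, b4, b5, b6⟩, ⟨c1, c2, c3⟩, ⟨d1, d2, d3⟩⟩ :=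
    bddOn_atoms (x := Sample.u) (t := Sample.t) (θ := Sample.θ) ht₀ ht
      (fun i hi => (hu i hi).null) (fun i hi => (hu i hi).value) (fun i hi => (hu i hi).metric)
  obtain ⟨m1, m2, m3, m4, m5, m6, m7, m8, m9, m10⟩ :=
    bddOn_moments (g := fun i => i.w.f) (t := Sample.t) (θ := Sample.θ) hf
  have w1 : BddOn S (fun i => i.w.μ i.t i.θ) := ⟨M, fun i hi => (hw i hi).μ⟩
  have w2 : BddOn S (fun i => i.w.A i.t i.θ) := ⟨M, fun i hi => (hw i hi).A⟩
  have w3 : BddOn S (fun i => i.w.J i.t i.θ) := ⟨M, fun i hi => (hw i hi).J⟩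
  have w4 : BddOn S (fun i => i.w.K i.t i.θ) := ⟨M, fun i hi => (hw i hi).K⟩
  have v1 := b4.comp_continuous hV.smooth.continuous
  refine ⟨?_, ?_, ?_⟩ <;>
  · simp only [Fields.ρ, Fields.P₁, Fields.ρ₁, Fields.kin]
    repeat' with_reducible first
      | assumption | exact BddOn.const _ | apply BddOn.add | apply BddOn.sub | apply BddOn.neg
      | apply BddOn.mul | apply BddOn.div | apply BddOn.pow
      | apply BddOn.exp | exact BddOn.inv_const _ | apply BddOn.inv_mul | apply BddOn.inv_pow

/-- Bounds for the expressions of `H_t` and `G_t` in terms of the twist quantities. -/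
lemma bddOn_shift_rates (ht₀ : 0 < t₀) (ht : ∀ i ∈ S, i.t ∈ Icc t₀ t₂)
    (h : ∀ i ∈ S, NullBound I M i.w i.t i.θ) (hv : ∀ i ∈ S, ValueBound M i.w i.t i.θ)
    (hm : ∀ i ∈ S, MetricBound M i.w i.t i.θ) :
    BddOn S (fun i => (i.w.A i.t i.θ * i.w.J i.t i.θ - i.w.K i.t i.θ) *
      (√(i.w.α i.t i.θ) * Real.exp (2 * i.w.τ i.t i.θ) / i.t ^ 3)) ∧
    BddOn S (fun i => -(i.w.J i.t i.θ * (√(i.w.α i.t i.θ) *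
        Real.exp (2 * i.w.τ i.t i.θ - 4 * i.w.μ i.t i.θ) / i.t)) -
      i.w.A i.t i.θ * ((i.w.A i.t i.θ * i.w.J i.t i.θ - i.w.K i.t i.θ) *
      (√(i.w.α i.t i.θ) * Real.exp (2 * i.w.τ i.t i.θ) / i.t ^ 3))) := by
  obtain ⟨s1, s2⟩ := bddOn_time ht₀ ht
  obtain ⟨⟨a1, a2, a3, a4, a5⟩, ⟨b1, b2, b3, b4, b5, b6⟩, -⟩ :=
    bddOn_atoms (x := Sample.w) (t := Sample.t) (θ := Sample.θ) ht₀ ht h hv hm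
  refine ⟨?_, ?_⟩ <;>
    repeat' with_reducible first
      | assumption | exact BddOn.const _ | apply BddOn.add | apply BddOn.sub | apply BddOn.neg
      | apply BddOn.mul | apply BddOn.div | apply BddOn.pow
      | apply BddOn.exp | exact BddOn.inv_const _ | apply BddOn.inv_mul | apply BddOn.inv_pow

lemma abs_apply_le_energy (v : Mom) (k : Fin 3) : |v k| ≤ energy v := by
  refine Real.abs_le_sqrt ?_
  fin_cases k <;> simp <;> nlinarith [sq_nonneg (v 0), sq_nonneg (v 1), sq_nonneg (v 2)]

/-- The norm on `Mom` is the sup norm, so the square of the energy is at most `1 + 3‖v‖² ≤ 4(1 +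
‖v‖)²`. -/
lemma energy_le (v : Mom) : energy v ≤ 2 * (1 + ‖v‖) := by
  have h : ∀ k, v k ^ 2 ≤ ‖v‖ ^ 2 := fun k => by
    rw [← sq_abs]
    exact pow_le_pow_left₀ (abs_nonneg _) (norm_le_pi_norm v k) 2
  refine Real.sqrt_le_iff.2 ⟨by positivity, ?_⟩
  nlinarith [h 0, h 1, h 2, norm_nonneg v]

/-- The momentum components of the characteristic vector field grow at most linearly. -/
lemma bddOn_Ξ (ht₀ : 0 < t₀) (ht : ∀ i ∈ S, i.t ∈ Icc t₀ t₂)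
    (hu : ∀ i ∈ S, FieldBound I M i.u i.t i.θ) (hr : ∀ i ∈ S, RateBound I M' i.u i.t i.θ) :
    ∃ C, ∀ i ∈ S, ‖i.u.Ξ I i.t i.θ i.v‖ ≤ C * (1 + ‖i.v‖) := by
  obtain ⟨s1, s2⟩ := bddOn_time ht₀ ht
  obtain ⟨⟨a1, a2, a3, a4, a5⟩, ⟨b1, b2, b3, b4, b5, b6⟩, ⟨c1, c2, c3⟩, ⟨d1, d2, d3⟩⟩ :=
    bddOn_atoms (x := Sample.u) (t := Sample.t) (θ := Sample.θ) ht₀ ht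
      (fun i hi => (hu i hi).null) (fun i hi => (hu i hi).value) (fun i hi => (hu i hi).metric)
  have r1 : BddOn S (fun i => dt I i.u.τ i.t i.θ) := ⟨M', fun i hi => (hr i hi).τ_t⟩
  -- The characteristic system contains `τ_θ` and `α_θ` only in this combination, which is the one
  -- bounded in `RateBound`; the first component is regrouped below to exhibit it.
  have r2 : BddOn S (fun i => dθ i.u.τ i.t i.θ + dθ i.u.α i.t i.θ / (2 * i.u.α i.t i.θ)) :=
    ⟨M', fun i hi => (hr i hi).β_θ⟩
  have hn : ∀ v : Mom, 0 < 1 + ‖v‖ := fun v => by positivity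
  -- After division by `1 + ‖v‖`, the terms quadratic in momentum become products of a ratio `v k /
  -- energy v` and a ratio `v j / (1 + ‖v‖)`, both at most `1` in modulus.
  have q : ∀ k, BddOn S (fun i => i.v k / (1 + ‖i.v‖)) := fun k => ⟨1, fun i _ => by
    rw [abs_div, abs_of_pos (hn i.v), div_le_one (hn i.v)]
    have := norm_le_pi_norm i.v k
    rw [Real.norm_eq_abs] at this
    linarith⟩
  have e : ∀ k, BddOn S (fun i => i.v k / energy i.v) := fun k => ⟨1, fun i _ => by
    rw [abs_div, abs_of_pos (energy_pos i.v), div_le_one (energy_pos i.v)]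
    exact abs_apply_le_energy _ _⟩
  have p : BddOn S (fun i => energy i.v / (1 + ‖i.v‖)) := ⟨2, fun i _ => by
    rw [abs_div, abs_of_pos (hn i.v), abs_of_pos (energy_pos i.v), div_le_iff₀ (hn i.v)]
    exact energy_le i.v⟩
  have q0 := q 0
  have q1 := q 1
  have q2 := q 2
  have e0 := e 0
  have e1 := e 1
  have e2 := e 2
  have x0 : BddOn S (fun i =>
      -(dθ i.u.τ i.t i.θ + dθ i.u.α i.t i.θ / (2 * i.u.α i.t i.θ) - dθ i.u.μ i.t i.θ)
        * √(i.u.α i.t i.θ) * (energy i.v / (1 + ‖i.v‖))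
      - (dt I i.u.τ i.t i.θ - dt I i.u.μ i.t i.θ) * (i.v 0 / (1 + ‖i.v‖))
      + √(i.u.α i.t i.θ) * dθ i.u.μ i.t i.θ * ((i.v 1 / energy i.v) * (i.v 1 / (1 + ‖i.v‖))
        - (i.v 2 / energy i.v) * (i.v 2 / (1 + ‖i.v‖)))
      + √(i.u.α i.t i.θ) * dθ i.u.A i.t i.θ / i.t * (i.v 1 / energy i.v)
        * Real.exp (2 * i.u.μ i.t i.θ) * (i.v 2 / (1 + ‖i.v‖))
      + √(i.u.α i.t i.θ) * Real.exp (i.u.τ i.t i.θ) / i.t ^ 2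
        * (i.u.K i.t i.θ - i.u.A i.t i.θ * i.u.J i.t i.θ) * (i.v 2 / (1 + ‖i.v‖))
      + √(i.u.α i.t i.θ) * Real.exp (i.u.τ i.t i.θ - 2 * i.u.μ i.t i.θ) / i.t * i.u.J i.t i.θ
        * (i.v 1 / (1 + ‖i.v‖))) := by
    repeat' with_reducible first
      | assumption | exact BddOn.const _ | apply BddOn.add | apply BddOn.sub | apply BddOn.neg
      | apply BddOn.mul | apply BddOn.div | apply BddOn.pow
      | apply BddOn.exp | exact BddOn.inv_const _ | apply BddOn.inv_mul | apply BddOn.inv_pow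
  have x1 : BddOn S (fun i => -(dt I i.u.μ i.t i.θ) * (i.v 1 / (1 + ‖i.v‖))
      - √(i.u.α i.t i.θ) * dθ i.u.μ i.t i.θ * (i.v 0 / energy i.v) * (i.v 1 / (1 + ‖i.v‖))) := by
    repeat' with_reducible first
      | assumption | exact BddOn.const _ | apply BddOn.add | apply BddOn.sub | apply BddOn.neg
      | apply BddOn.mul
  have x2 : BddOn S (fun i => -(1 / i.t - dt I i.u.μ i.t i.θ) * (i.v 2 / (1 + ‖i.v‖))
      + √(i.u.α i.t i.θ) * dθ i.u.μ i.t i.θ * (i.v 0 / energy i.v) * (i.v 2 / (1 + ‖i.v‖))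
      - Real.exp (2 * i.u.μ i.t i.θ) / i.t * (dt I i.u.A i.t i.θ
        + √(i.u.α i.t i.θ) * dθ i.u.A i.t i.θ * (i.v 0 / energy i.v))
        * (i.v 1 / (1 + ‖i.v‖))) := by
    repeat' with_reducible first
      | assumption | exact BddOn.const _ | apply BddOn.add | apply BddOn.sub | apply BddOn.neg
      | apply BddOn.mul | apply BddOn.div | apply BddOn.exp
  obtain ⟨C0, h0⟩ := x0
  obtain ⟨C1, h1⟩ := x1
  obtain ⟨C2, h2⟩ := x2
  refine ⟨max C0 (max C1 C2), fun i hi => ?_⟩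
  have hC : 0 ≤ max C0 (max C1 C2) := ((abs_nonneg _).trans (h0 i hi)).trans (le_max_left _ _)
  have hp := hn i.v
  have hE := energy_pos i.v
  have hα := (hu i hi).null.α_pos
  have hti := ht₀.trans_le (ht i hi).1
  refine (pi_norm_le_iff_of_nonneg (mul_nonneg hC hp.le)).2 fun k => ?_
  rw [Real.norm_eq_abs, ← div_le_iff₀ hp]
  rw [← abs_of_pos hp, ← abs_div]
  fin_cases k
  · refine Eq.trans_le (congrArg _ ?_) ((h0 i hi).trans (le_max_left _ _))
    simp only [Fields.Ξ, Fin.zero_eta, Matrix.cons_val_zero]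
    field_simp
    ring
  · refine Eq.trans_le (congrArg _ ?_) ((h1 i hi).trans ((le_max_left _ _).trans (le_max_right _ _)))
    simp only [Fields.Ξ, Fin.mk_one, Matrix.cons_val_one, Matrix.cons_val_zero]
    field_simp
  · refine Eq.trans_le (congrArg _ ?_) ((h2 i hi).trans ((le_max_right _ _).trans (le_max_right _ _)))
    simp only [Fields.Ξ, Fin.reduceFinMk, Matrix.cons_val]
    field_simp

end Samples

/-- In this form finitely many bounds are given a common constant by intersecting eventual
statements. -/
lemma BddOn.eventually {ι : Type*} {S : Set ι} {f : ι → ℝ} (h : BddOn S f) :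
    ∀ᶠ C in Filter.atTop, ∀ i ∈ S, |f i| ≤ C := by
  obtain ⟨C, hC⟩ := h
  filter_upwards [Filter.eventually_ge_atTop C] with D hD i hi using (hC i hi).trans hD

/-! ### Regular fields are locally bounded -/

section RegularFields

variable {V : ℝ → ℝ} {t₀ T t₂ : ℝ} {u : Fields}

lemma Fields.IsRegular.regularOn_φ (hu : u.IsRegular (Ico t₀ T)) :
    RegularOn 1 (Ico t₀ T) (u.dς (Ico t₀ T) u.φ) ∧
    RegularOn 1 (Ico t₀ T) (u.dξ (Ico t₀ T) u.φ) := by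
  have hα := (hu.α.mono one_le_two).sqrt hu.α_pos
  exact ⟨hu.φ.regularOn_dt.add (hα.mul hu.φ.regularOn_dθ),
    hu.φ.regularOn_dt.sub (hα.mul hu.φ.regularOn_dθ)⟩

/-- Class `C²` for `α`, `μ`, `A` gives the null quantities the `C¹` regularity that the maximum
principle asks for. -/
lemma Fields.IsRegular.regularOn_Υ (ht₀ : 0 < t₀) (hu : u.IsRegular (Ico t₀ T)) :
    RegularOn 1 (Ico t₀ T) (fun s x => u.Υ (Ico t₀ T) s x + u.Υx (Ico t₀ T) s x) ∧
    RegularOn 1 (Ico t₀ T) (fun s x => u.Υ (Ico t₀ T) s x - u.Υx (Ico t₀ T) s x) := by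
  have hα := hu.α.mono one_le_two
  have he : RegularOn 1 (Ico t₀ T) (fun s x => Real.exp (4 * u.μ s x) / (4 * s ^ 2)) := by
    refine (((RegularOn.const 4).mul (hu.μ.mono one_le_two)).exp).div
      ((RegularOn.const 4).mul (RegularOn.time.pow 2)) fun t ht θ => ?_
    have := ht₀.trans_le ht.1
    positivity
  have h1 : RegularOn 1 (Ico t₀ T) (u.Υ (Ico t₀ T)) :=
    ((hu.μ.regularOn_dt.pow 2).add (hα.mul (hu.μ.regularOn_dθ.pow 2))).add
      (he.mul ((hu.A.regularOn_dt.pow 2).add (hα.mul (hu.A.regularOn_dθ.pow 2))))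
  have h2 : RegularOn 1 (Ico t₀ T) (u.Υx (Ico t₀ T)) :=
    ((RegularOn.const 2).mul (hα.sqrt hu.α_pos)).mul ((hu.μ.regularOn_dt.mul hu.μ.regularOn_dθ).add
      (he.mul (hu.A.regularOn_dt.mul hu.A.regularOn_dθ)))
  exact ⟨h1.add h2, h1.sub h2⟩

lemma RegularOn.eventually_bound {k : ℕ} {χ : ℝ → ℝ → ℝ} (h : RegularOn k (Ico t₀ T) χ)
    (ht₂ : t₂ < T) : ∀ᶠ C in Filter.atTop, ∀ t ∈ Icc t₀ t₂, ∀ θ, |χ t θ| ≤ C := by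
  obtain ⟨C, hC⟩ := h.exists_bound ht₂
  filter_upwards [Filter.eventually_ge_atTop C] with D hD t ht θ using (hC t ht θ).trans hD

lemma RegularDistribution.eventually_bound {f : ℝ → ℝ → Mom → ℝ}
    (h : RegularDistribution (Ico t₀ T) f) (ht₂ : t₂ < T) :
    ∀ᶠ C in Filter.atTop, ∀ t ∈ Icc t₀ t₂, ∀ θ, DistBound C f t θ := by
  obtain ⟨h1, h2, -, h4⟩ := h
  have hsub : Icc t₀ t₂ ⊆ Ico t₀ T := fun s hs => ⟨hs.1, hs.2.trans_lt ht₂⟩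
  obtain ⟨R, hR⟩ := h4 _ hsub isCompact_Icc
  obtain ⟨C, hC⟩ := ((isCompact_Icc (a := t₀) (b := t₂)).prod
    ((isCompact_Icc (a := 0) (b := 2 * Real.pi)).prod
      (isCompact_closedBall (0 : Mom) R))).exists_bound_of_continuousOn
    (h1.continuousOn.mono (prod_mono hsub (subset_univ _)))
  filter_upwards [Filter.eventually_ge_atTop C, Filter.eventually_ge_atTop R,
    Filter.eventually_ge_atTop 0] with D hCD hRD h0 t ht θ
  refine ⟨fun v => ?_, fun v hv => (hR t ht θ v hv).trans hRD⟩
  by_cases hv : f t θ v = 0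
  · rwa [hv, abs_zero]
  · have hvR := hR t ht θ v hv
    obtain ⟨θ', hθ', he⟩ := two_pi_periodic_reduce (g := fun x => f t x v)
      (fun x => h2 t (hsub ht) x v) θ
    rw [show f t θ v = f t θ' v from he]
    exact (hC (t, θ', v) ⟨ht, hθ', by simpa using hvR⟩).trans hCD

/-- Supplies the base of the induction, where no equation is available: bounds come from compactness
of the closed time interval and periodicity. The fields may blow up at `T`, hence `t₂ < T`. -/
lemma Fields.IsRegular.eventually_fieldBound (ht₀ : 0 < t₀) (ht₂ : t₂ < T)
    (hu : u.IsRegular (Ico t₀ T)) :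
    ∀ᶠ M in Filter.atTop, ∀ t ∈ Icc t₀ t₂, ∀ θ, FieldBound (Ico t₀ T) M u t θ := by
  filter_upwards [hu.f.eventually_bound ht₂, (hu.regularOn_Υ ht₀).1.eventually_bound ht₂,
    (hu.regularOn_Υ ht₀).2.eventually_bound ht₂, hu.regularOn_φ.1.eventually_bound ht₂,
    hu.regularOn_φ.2.eventually_bound ht₂, hu.μ.eventually_bound ht₂, hu.A.eventually_bound ht₂,
    hu.φ.eventually_bound ht₂, hu.J.eventually_bound ht₂, hu.K.eventually_bound ht₂,
    (hu.α.log hu.α_pos).eventually_bound ht₂, hu.τ.eventually_bound ht₂,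
    hu.G.eventually_bound ht₂, hu.H.eventually_bound ht₂]
    with M h1 h2 h3 h4 h5 h6 h7 h8 h9 h10 h11 h12 h13 h14 t ht θ
  exact ⟨h1 t ht θ, ⟨hu.α_pos t ⟨ht.1, ht.2.trans_lt ht₂⟩ θ, h2 t ht θ, h3 t ht θ, h4 t ht θ,
    h5 t ht θ⟩, ⟨h6 t ht θ, h7 t ht θ, h8 t ht θ, h9 t ht θ, h10 t ht θ⟩, ⟨h11 t ht θ, h12 t ht θ⟩,
    ⟨h13 t ht θ, h14 t ht θ⟩⟩

lemma Fields.IsRegular.eventually_rateBound (ht₂ : t₂ < T) (hu : u.IsRegular (Ico t₀ T)) :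
    ∀ᶠ M in Filter.atTop, ∀ t ∈ Icc t₀ t₂, ∀ θ, RateBound (Ico t₀ T) M u t θ := by
  have hα := hu.α.mono one_le_two
  have h0 : ∀ t ∈ Ico t₀ T, ∀ θ, u.α t θ ≠ 0 := fun t ht θ => (hu.α_pos t ht θ).ne'
  filter_upwards [(hu.α.regularOn_dt.div hα h0).eventually_bound ht₂,
    hu.τ.regularOn_dt.eventually_bound ht₂, (hu.τ.regularOn_dθ.add (hu.α.regularOn_dθ.div
      ((RegularOn.const 2).mul hα) fun t ht θ => mul_ne_zero two_ne_zero
        (h0 t ht θ))).eventually_bound ht₂] with M h1 h2 h3 t ht θ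
  exact ⟨h1 t ht θ, h2 t ht θ, h3 t ht θ⟩

end RegularFields

/-! ### Initial data -/

section Initial

variable {t₀ T : ℝ} {D : InitialData}

lemma bddOn_of_continuous_periodic {g : ℝ → ℝ} (hg : Continuous g)
    (hp : Function.Periodic g (2 * Real.pi)) : BddOn univ g := by
  obtain ⟨C, hC⟩ := (isCompact_Icc (a := 0) (b := 2 * Real.pi)).exists_bound_of_continuousOn
    hg.continuousOn
  refine ⟨C, fun θ _ => ?_⟩
  obtain ⟨θ', hθ', he⟩ := two_pi_periodic_reduce hp θ
  rw [he]
  exact hC θ' hθ'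

lemma RegularDatum.bddOn {k : ℕ} {χ : ℝ → ℝ} (h : RegularDatum k χ) : BddOn univ χ :=
  bddOn_of_continuous_periodic h.1.continuous h.2

lemma RegularDatum.bddOn_deriv {χ : ℝ → ℝ} (h : RegularDatum 2 χ) : BddOn univ (deriv χ) := by
  refine bddOn_of_continuous_periodic (h.1.continuous_deriv (by norm_num)) fun θ => ?_
  have : (fun x => χ (x + 2 * Real.pi)) = χ := funext h.2
  rw [← deriv_comp_add_const, this]

lemma InitialData.IsRegular.eventually_dist (hD : D.IsRegular) :
    ∀ᶠ C in Filter.atTop, ∀ θ v, |D.f θ v| ≤ C ∧ (D.f θ v ≠ 0 → ‖v‖ ≤ C) := by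
  obtain ⟨R, hR⟩ := hD.f_support
  obtain ⟨C, hC⟩ := ((isCompact_Icc (a := 0) (b := 2 * Real.pi)).prod
    (isCompact_closedBall (0 : Mom) R)).exists_bound_of_continuousOn
    hD.f_smooth.continuous.continuousOn
  filter_upwards [Filter.eventually_ge_atTop C, Filter.eventually_ge_atTop R,
    Filter.eventually_ge_atTop 0] with D' hCD hRD h0 θ v
  refine ⟨?_, fun hv => (hR θ v hv).trans hRD⟩
  by_cases hv : D.f θ v = 0
  · rwa [hv, abs_zero]
  · have hvR := hR θ v hv
    obtain ⟨θ', hθ', he⟩ := two_pi_periodic_reduce (g := fun x => D.f x v)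
      (fun x => hD.f_periodic x v) θ
    rw [show D.f θ v = D.f θ' v from he]
    exact (hC (θ', v) ⟨hθ', by simpa using hvR⟩).trans hCD

/-- Uniform bounds at the initial time. -/
lemma InitialData.IsRegular.eventually_fieldBound (hD : D.IsRegular) (I : Set ℝ) :
    ∀ᶠ E in Filter.atTop, ∀ w : Fields, HasInitialValues t₀ D w →
      (∀ θ, dt I w.μ t₀ θ = D.μ' θ ∧ dt I w.A t₀ θ = D.A' θ ∧ dt I w.φ t₀ θ = D.φ' θ) →
      ∀ θ, FieldBound I E w t₀ θ := by
  have a1 := hD.α.bddOn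
  have a2 : BddOn univ (fun θ => √(D.α θ)) := bddOn_of_continuous_periodic
    hD.α.1.continuous.sqrt fun θ => by simp only [hD.α.2 θ]
  have a3 : BddOn univ (fun θ => Real.log (D.α θ)) := bddOn_of_continuous_periodic
    (hD.α.1.continuous.log fun θ => (hD.α_pos θ).ne') fun θ => by simp only [hD.α.2 θ]
  have b1 := hD.μ.bddOn
  have b2 := hD.A.bddOn
  have c1 := hD.μ'.bddOn
  have c2 := hD.A'.bddOn
  have c3 := hD.φ'.bddOn
  have d1 := hD.μ.bddOn_deriv
  have d2 := hD.A.bddOn_deriv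
  have d3 := hD.φ.bddOn_deriv
  have x1 : BddOn univ (fun θ => D.μ' θ ^ 2 + D.α θ * deriv D.μ θ ^ 2 +
      Real.exp (4 * D.μ θ) / (4 * t₀ ^ 2) * (D.A' θ ^ 2 + D.α θ * deriv D.A θ ^ 2) +
      2 * √(D.α θ) * (D.μ' θ * deriv D.μ θ +
        Real.exp (4 * D.μ θ) / (4 * t₀ ^ 2) * (D.A' θ * deriv D.A θ))) := by
    repeat' with_reducible first
      | assumption | exact BddOn.const _ | apply BddOn.add | apply BddOn.mul | apply BddOn.pow
      | apply BddOn.div | apply BddOn.exp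
  have x2 : BddOn univ (fun θ => D.μ' θ ^ 2 + D.α θ * deriv D.μ θ ^ 2 +
      Real.exp (4 * D.μ θ) / (4 * t₀ ^ 2) * (D.A' θ ^ 2 + D.α θ * deriv D.A θ ^ 2) -
      2 * √(D.α θ) * (D.μ' θ * deriv D.μ θ +
        Real.exp (4 * D.μ θ) / (4 * t₀ ^ 2) * (D.A' θ * deriv D.A θ))) := by
    repeat' with_reducible first
      | assumption | exact BddOn.const _ | apply BddOn.sub | apply BddOn.add | apply BddOn.mul
      | apply BddOn.pow | apply BddOn.div | apply BddOn.exp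
  filter_upwards [hD.eventually_dist, x1.eventually, x2.eventually,
    (c3.add (a2.mul d3)).eventually, (c3.sub (a2.mul d3)).eventually, b1.eventually,
    b2.eventually, hD.φ.bddOn.eventually, hD.J.bddOn.eventually, hD.K.bddOn.eventually,
    a3.eventually, hD.τ.bddOn.eventually, hD.G.bddOn.eventually, hD.H.bddOn.eventually]
    with E e1 e2 e3 e4 e5 e6 e7 e8 e9 e10 e11 e12 e13 e14 w hw hdt θ
  -- The initial values also fix the spatial derivatives at `t₀`, so every quantity to be bounded
  -- there depends on `D` alone.
  have hμ : dθ w.μ t₀ θ = deriv D.μ θ :=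
    congrArg (fun g => deriv g θ) (funext fun x => (hw x).2.2.1)
  have hA : dθ w.A t₀ θ = deriv D.A θ :=
    congrArg (fun g => deriv g θ) (funext fun x => (hw x).2.2.2.1)
  have hφ : dθ w.φ t₀ θ = deriv D.φ θ :=
    congrArg (fun g => deriv g θ) (funext fun x => (hw x).2.2.2.2.2.2.2.2.1)
  obtain ⟨hμ', hA', hφ'⟩ := hdt θ
  obtain ⟨w1, w2, w3, w4, w5, w6, w7, w8, w9, w10⟩ := hw θ
  refine ⟨⟨fun v => ?_, fun v => ?_⟩, ⟨?_, ?_, ?_, ?_, ?_⟩, ⟨?_, ?_, ?_, ?_, ?_⟩, ⟨?_, ?_⟩,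
    ⟨?_, ?_⟩⟩
  · exact w10 v ▸ (e1 θ v).1
  · exact w10 v ▸ (e1 θ v).2
  · exact w1 ▸ hD.α_pos θ
  · rw [Fields.Υ, Fields.Υx, hμ, hA, hμ', hA', w1, w3]
    exact e2 θ (mem_univ θ)
  · rw [Fields.Υ, Fields.Υx, hμ, hA, hμ', hA', w1, w3]
    exact e3 θ (mem_univ θ)
  · rw [Fields.dς, hφ, hφ', w1]
    exact e4 θ (mem_univ θ)
  · rw [Fields.dξ, hφ, hφ', w1]
    exact e5 θ (mem_univ θ)
  · exact w3 ▸ e6 θ (mem_univ θ)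
  · exact w4 ▸ e7 θ (mem_univ θ)
  · exact w9 ▸ e8 θ (mem_univ θ)
  · exact w7 ▸ e9 θ (mem_univ θ)
  · exact w8 ▸ e10 θ (mem_univ θ)
  · exact w1 ▸ e11 θ (mem_univ θ)
  · exact w2 ▸ e12 θ (mem_univ θ)
  · exact w5 ▸ e13 θ (mem_univ θ)
  · exact w6 ▸ e14 θ (mem_univ θ)

end Initial

/-! ### Consequences of the equations of one step -/

section Step

variable {V : ℝ → ℝ} {t₀ : ℝ} {I : Set ℝ} {D : InitialData} {u w : Fields} {t θ : ℝ}

lemma mul_exp_eq (hα : 0 < w.α t θ) :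
    Real.exp (Real.log (w.α t θ) + 2 * w.τ t θ) = w.α t θ * Real.exp (2 * w.τ t θ) := by
  rw [Real.exp_add, Real.exp_log hα]

lemma exp_two_mul_sub (a b : ℝ) : Real.exp (2 * (a - b)) = Real.exp (2 * a) * Real.exp (-2 * b) := by
  rw [← Real.exp_add]
  ring_nf

lemma exp_sub_four_mul (a b : ℝ) : Real.exp (a - 4 * b) = Real.exp a * Real.exp (-4 * b) := by
  rw [← Real.exp_add]
  ring_nf

/-- Isolates the factor `α e^{2τ}` of the new iterate, as `exists_time_pair_bound` requires. The
cofactor contains the metric functions `α`, `τ` only through the scalar field part of the matter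
terms, where they are those of `u`. -/
lemma IsStep.dt_log_α (h : IsStep V I t₀ D u w) (ht : t ∈ I) (hα : 0 < w.α t θ) :
    dt I w.α t θ / w.α t θ = Real.exp (Real.log (w.α t θ) + 2 * w.τ t θ) *
      (-(Real.exp (-4 * w.μ t θ) / t * w.J t θ ^ 2)
      - 1 / t ^ 3 * (w.K t θ - w.A t θ * w.J t θ) ^ 2
      - 2 * t * Real.exp (-2 * w.μ t θ) * (u.ρ I V w.f t θ - u.P₁ I V w.f t θ)) := by
  rw [h.α_t t ht θ, mul_exp_eq hα, exp_two_mul_sub, exp_sub_four_mul]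
  ring

lemma IsStep.dt_τ (h : IsStep V I t₀ D u w) (ht : t ∈ I) (hα : 0 < w.α t θ) :
    dt I w.τ t θ = t * w.Υ I t θ + Real.exp (Real.log (w.α t θ) + 2 * w.τ t θ) *
      (Real.exp (-4 * w.μ t θ) / (4 * t) * w.J t θ ^ 2
      + 1 / (4 * t ^ 3) * (w.K t θ - w.A t θ * w.J t θ) ^ 2
      + t * Real.exp (-2 * w.μ t θ) * u.ρ I V w.f t θ) := by
  rw [h.τ_t t ht θ, mul_exp_eq hα, exp_two_mul_sub, exp_sub_four_mul]
  ring

/-- The combination needed in the characteristic system is given algebraically, without separate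
control of `α_θ`. -/
lemma IsStep.dθ_β (h : IsStep V I t₀ D u w) (ht : t ∈ I) :
    dθ w.τ t θ + dθ w.α t θ / (2 * w.α t θ) = t * w.Υx I t θ / √(w.α t θ) -
      √(w.α t θ) * Real.exp (2 * w.τ t θ) *
        (t * Real.exp (-2 * w.μ t θ) * u.ρ₁ I w.f t θ) := by
  rw [h.τ_θ t ht θ, exp_two_mul_sub]
  ring

/-- The twist relations are solved for the time derivatives of the shifts: `H` from the relation for
`K`, then `G` from that for `J`, which contains `H_t`. -/
lemma IsStep.dt_H (h : IsStep V I t₀ D u w) (ht : t ∈ I) (h0 : 0 < t) (hα : 0 < w.α t θ) :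
    dt I w.H t θ = (w.A t θ * w.J t θ - w.K t θ) *
      (√(w.α t θ) * Real.exp (2 * w.τ t θ) / t ^ 3) := by
  have hs := (Real.sqrt_pos.2 hα).ne'
  rw [h.twist_K t ht θ, neg_mul, Real.exp_neg]
  have := (Real.exp_pos (2 * w.τ t θ)).ne'
  field_simp
  ring

lemma IsStep.dt_G (h : IsStep V I t₀ D u w) (ht : t ∈ I) (h0 : 0 < t) (hα : 0 < w.α t θ) :
    dt I w.G t θ = -(w.J t θ * (√(w.α t θ) * Real.exp (2 * w.τ t θ - 4 * w.μ t θ) / t)) -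
      w.A t θ * ((w.A t θ * w.J t θ - w.K t θ) *
        (√(w.α t θ) * Real.exp (2 * w.τ t θ) / t ^ 3)) := by
  have hs := (Real.sqrt_pos.2 hα).ne'
  have hJ := h.twist_J t ht θ
  have he : Real.exp (-2 * w.τ t θ + 4 * w.μ t θ) =
      (Real.exp (2 * w.τ t θ - 4 * w.μ t θ))⁻¹ := by
    rw [← Real.exp_neg]
    ring_nf
  rw [← h.dt_H ht h0 hα, eq_sub_iff_add_eq, hJ, he]
  have := (Real.exp_pos (2 * w.τ t θ - 4 * w.μ t θ)).ne'
  field_simp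

end Step

/-! ### The induction step -/

section Induction

variable {V : ℝ → ℝ} {t₀ T t₂ M M' E : ℝ} {D : InitialData}

/-- Short time control of the distribution function. -/
lemma exists_time_dist (ht₀ : 0 < t₀) (ht₂ : t₂ < T) (hEM : E + 1 ≤ M) (M' : ℝ) :
    ∃ δ > 0, ∀ t₁ ≤ t₂, t₁ ≤ t₀ + δ → ∀ u w : Fields,
      SolvesVlasov (Ico t₀ T) t₀ u D.f w.f → (∀ θ v, w.f t₀ θ v = D.f θ v) →
      (∀ θ, DistBound E w.f t₀ θ) →
      (∀ t ∈ Icc t₀ t₁, ∀ θ, FieldBound (Ico t₀ T) M u t θ) →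
      (∀ t ∈ Icc t₀ t₁, ∀ θ, RateBound (Ico t₀ T) M' u t θ) →
      ∀ t ∈ Icc t₀ t₁, ∀ θ, DistBound M w.f t θ := by
  obtain ⟨C, hC⟩ := bddOn_Ξ (S := {i : Sample | i.t ∈ Icc t₀ t₂ ∧
    FieldBound (Ico t₀ T) M i.u i.t i.θ ∧ RateBound (Ico t₀ T) M' i.u i.t i.θ})
    ht₀ (fun i hi => hi.1) (fun i hi => hi.2.1) (fun i hi => hi.2.2)
  obtain ⟨δ, hδ, hg⟩ := exists_time_gronwall (E := Mom) C E
  refine ⟨δ, hδ, fun t₁ h₁ h₁' u w hsol hin h0 hu hr t ht θ => ?_⟩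
  refine ⟨fun v => ?_, fun v hv => ?_⟩ <;>
    obtain ⟨Θ, W, -, hW, -, hWt, hf⟩ := hsol t ⟨ht.1, (ht.2.trans h₁).trans_lt ht₂⟩ θ v
  -- The distribution function is transported along characteristics, so its supremum does not grow.
  · rw [hf, ← hin]
    linarith [(h0 (Θ t₀)).val (W t₀)]
  · rw [hf, ← hin] at hv
    rw [← hWt]
    -- A characteristic that reaches a point of the support starts in the initial support, where `‖W
    -- t₀‖ ≤ E`; Grönwall gives `‖v‖ ≤ E + 1 ≤ M`.
    refine (hg t₀ t ht.1 (ht.2.trans h₁') W _ hW ((h0 _).supp _ hv) fun s hs => ?_).trans hEM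
    have hs' : s ∈ Icc t₀ t₁ := ⟨hs.1, hs.2.trans ht.2⟩
    exact hC ⟨u, w, s, Θ s, W s⟩ ⟨⟨hs.1, hs'.2.trans h₁⟩, hu s hs' _, hr s hs' _⟩

/-- If an iterate obeys the bounds `M` and `M'` on a short time interval, then the next iterate
obeys the bound `M` there. -/
lemma exists_time_step (hV : IsPotential V) (ht₀ : 0 < t₀) (ht₂ : t₂ < T) (hEM : E + 1 ≤ M)
    (M' : ℝ) :
    ∃ δ > 0, ∀ t₁ ≤ t₂, t₁ ≤ t₀ + δ → ∀ u w : Fields, w.IsRegular (Ico t₀ T) →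
      IsStep V (Ico t₀ T) t₀ D u w → HasInitialValues t₀ D w →
      (∀ θ, FieldBound (Ico t₀ T) E w t₀ θ) →
      (∀ t ∈ Icc t₀ t₁, ∀ θ, FieldBound (Ico t₀ T) M u t θ) →
      (∀ t ∈ Icc t₀ t₁, ∀ θ, RateBound (Ico t₀ T) M' u t θ) →
      ∀ t ∈ Icc t₀ t₁, ∀ θ, FieldBound (Ico t₀ T) M w t θ := by
  set I := Ico t₀ T with hI
  obtain ⟨δ₁, hδ₁, hdist⟩ := exists_time_dist (D := D) ht₀ ht₂ hEM M'
  -- Each sample set from here on imposes only bounds that are already established when the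
  -- resulting estimate is applied.
  obtain ⟨⟨r1, r2⟩, ⟨r3, r4⟩, r5, r6⟩ := bddOn_sources (S := {i : Sample | i.t ∈ Icc t₀ t₂ ∧
    FieldBound I M i.u i.t i.θ ∧ RateBound I M' i.u i.t i.θ ∧ DistBound M i.w.f i.t i.θ}) hV
    ht₀ (fun i hi => hi.1) (fun i hi => hi.2.1) (fun i hi => hi.2.2.1) (fun i hi => hi.2.2.2)
  obtain ⟨n1, n2⟩ := bddOn_dt_μ_φ (S := {i : Sample | NullBound I M i.w i.t i.θ})
    (x := Sample.w) (t := Sample.t) (θ := Sample.θ) fun i hi => hi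
  have n3 := bddOn_dt_A (S := {i : Sample | i.t ∈ Icc t₀ t₂ ∧ NullBound I M i.w i.t i.θ ∧
    |i.w.μ i.t i.θ| ≤ M}) (x := Sample.w) (t := Sample.t) (θ := Sample.θ)
    ht₀ (fun i hi => hi.1) (fun i hi => hi.2.1) (fun i hi => hi.2.2)
  obtain ⟨c1, c2, -⟩ := bddOn_constraint_terms (S := {i : Sample | i.t ∈ Icc t₀ t₂ ∧
    FieldBound I M i.u i.t i.θ ∧ DistBound M i.w.f i.t i.θ ∧ ValueBound M i.w i.t i.θ}) hV
    ht₀ (fun i hi => hi.1) (fun i hi => hi.2.1) (fun i hi => hi.2.2.1) (fun i hi => hi.2.2.2)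
  obtain ⟨s1, s2⟩ := bddOn_shift_rates (S := {i : Sample | i.t ∈ Icc t₀ t₂ ∧
    NullBound I M i.w i.t i.θ ∧ ValueBound M i.w i.t i.θ ∧ MetricBound M i.w i.t i.θ})
    ht₀ (fun i hi => hi.1) (fun i hi => hi.2.1) (fun i hi => hi.2.2.1) (fun i hi => hi.2.2.2)
  -- One constant serves all growth rates; the condition `t₂ * M ≤ C` takes care of the term `t Υ`
  -- in the equation for `τ_t`.
  obtain ⟨C, hC0, hCM, ⟨⟨h1, h2⟩, h3, h4⟩, ⟨h5, h6⟩, ⟨h7, h8, h9⟩, ⟨h10, h11⟩, h12, h13⟩ :=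
    ((Filter.eventually_gt_atTop 0).and ((Filter.eventually_ge_atTop (t₂ * M)).and
      (((r1.eventually.and r2.eventually).and (r3.eventually.and r4.eventually)).and
      ((r5.eventually.and r6.eventually).and ((n1.eventually.and (n2.eventually.and
      n3.eventually)).and ((c1.eventually.and c2.eventually).and
      (s1.eventually.and s2.eventually))))))).exists
  obtain ⟨δ₂, hδ₂, hpair⟩ := exists_time_pair_bound C E
  -- Within time `C⁻¹` a quantity of growth rate at most `C` rises from `E` to at most `E + 1 ≤ M`.
  refine ⟨min (min δ₁ δ₂) C⁻¹, by positivity, fun t₁ h₁ h₁' u w hw hstep hin h0 hu hr => ?_⟩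
  have e1 : t₁ ≤ t₀ + δ₁ :=
    h₁'.trans (by gcongr; exact (min_le_left _ _).trans (min_le_left _ _))
  have e2 : t₁ ≤ t₀ + δ₂ :=
    h₁'.trans (by gcongr; exact (min_le_left _ _).trans (min_le_right _ _))
  have e3 : ∀ t ∈ Icc t₀ t₁, E + C * (t - t₀) ≤ M := by
    intro t ht
    have : t - t₀ ≤ C⁻¹ := by
      have := min_le_right (min δ₁ δ₂) C⁻¹
      linarith [ht.2]
    have : C * (t - t₀) ≤ C * C⁻¹ := by gcongr
    rw [mul_inv_cancel₀ hC0.ne'] at this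
    linarith
  have hlt : t₁ < T := h₁.trans_lt ht₂
  have htI : ∀ t ∈ Icc t₀ t₁, t ∈ I := fun t ht => ⟨ht.1, ht.2.trans_lt hlt⟩
  have ht2 : ∀ t ∈ Icc t₀ t₁, t ∈ Icc t₀ t₂ := fun t ht => ⟨ht.1, ht.2.trans h₁⟩
  have hα : ∀ t ∈ Icc t₀ t₁, ∀ θ, 0 < w.α t θ := fun t ht => hw.α_pos t (htI t ht)
  -- The distribution function comes first because the wave equations for the new `μ` and `A`
  -- contain the new matter moments.
  have fd := hdist t₁ h₁ e1 u w hstep.vlasov (fun θ => (hin θ).2.2.2.2.2.2.2.2.2)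
    (fun θ => (h0 θ).dist) hu hr
  have smp : ∀ t ∈ Icc t₀ t₁, ∀ θ, (⟨u, w, t, θ, 0⟩ : Sample) ∈ {i : Sample | i.t ∈ Icc t₀ t₂ ∧
      FieldBound I M i.u i.t i.θ ∧ RateBound I M' i.u i.t i.θ ∧ DistBound M i.w.f i.t i.θ} :=
    fun t ht θ => ⟨ht2 t ht, hu t ht θ, hr t ht θ, fd t ht θ⟩
  have fφ1 : ∀ t ∈ Icc t₀ t₁, ∀ θ, |w.dς I w.φ t θ| ≤ M := fun t ht θ =>
    (hw.regularOn_φ.1.abs_le_of_transport_le hlt (c := fun t θ => -√(u.α t θ)) (fun t ht θ => by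
      rw [neg_mul, ← sub_eq_add_neg]
      exact (congrArg abs (hstep.φ_ξ t (htI t ht) θ)).trans_le <| h1 ⟨u, w, t, θ, 0⟩ (smp t ht θ))
      (fun θ => (h0 θ).null.φ_add) t ht θ).trans (e3 t ht)
  have fφ2 : ∀ t ∈ Icc t₀ t₁, ∀ θ, |w.dξ I w.φ t θ| ≤ M := fun t ht θ =>
    (hw.regularOn_φ.2.abs_le_of_transport_le hlt (c := fun t θ => √(u.α t θ)) (fun t ht θ =>
      (congrArg abs (hstep.φ_ς t (htI t ht) θ)).trans_le <| h2 ⟨u, w, t, θ, 0⟩ (smp t ht θ))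
      (fun θ => (h0 θ).null.φ_sub) t ht θ).trans (e3 t ht)
  have fΥ1 : ∀ t ∈ Icc t₀ t₁, ∀ θ, |w.Υ I t θ + w.Υx I t θ| ≤ M := fun t ht θ =>
    ((hw.regularOn_Υ ht₀).1.abs_le_of_transport_le hlt (c := fun t θ => -√(u.α t θ))
      (fun t ht θ => by
        rw [neg_mul, ← sub_eq_add_neg]
        exact (congrArg abs (hstep.Υ_ξ t (htI t ht) θ)).trans_le <| h3 ⟨u, w, t, θ, 0⟩ (smp t ht θ))
      (fun θ => (h0 θ).null.Υ_add) t ht θ).trans (e3 t ht)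
  have fΥ2 : ∀ t ∈ Icc t₀ t₁, ∀ θ, |w.Υ I t θ - w.Υx I t θ| ≤ M := fun t ht θ =>
    ((hw.regularOn_Υ ht₀).2.abs_le_of_transport_le hlt (c := fun t θ => √(u.α t θ))
      (fun t ht θ => (congrArg abs (hstep.Υ_ς t (htI t ht) θ)).trans_le <|
        h4 ⟨u, w, t, θ, 0⟩ (smp t ht θ))
      (fun θ => (h0 θ).null.Υ_sub) t ht θ).trans (e3 t ht)
  have fJ : ∀ t ∈ Icc t₀ t₁, ∀ θ, |w.J t θ| ≤ M := fun t ht θ =>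
    (hw.J.abs_le_of_abs_dt_le hlt (fun t ht θ =>
      (congrArg abs (hstep.J_t t (htI t ht) θ)).trans_le <| h5 ⟨u, w, t, θ, 0⟩ (smp t ht θ))
      (fun θ => (h0 θ).value.J) t ht θ).trans (e3 t ht)
  have fK : ∀ t ∈ Icc t₀ t₁, ∀ θ, |w.K t θ| ≤ M := fun t ht θ =>
    (hw.K.abs_le_of_abs_dt_le hlt (fun t ht θ =>
      (congrArg abs (hstep.K_t t (htI t ht) θ)).trans_le <| h6 ⟨u, w, t, θ, 0⟩ (smp t ht θ))
      (fun θ => (h0 θ).value.K) t ht θ).trans (e3 t ht)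
  have fnull : ∀ t ∈ Icc t₀ t₁, ∀ θ, NullBound I M w t θ := fun t ht θ =>
    ⟨hα t ht θ, fΥ1 t ht θ, fΥ2 t ht θ, fφ1 t ht θ, fφ2 t ht θ⟩
  have fμ : ∀ t ∈ Icc t₀ t₁, ∀ θ, |w.μ t θ| ≤ M := fun t ht θ =>
    ((hw.μ.mono one_le_two).abs_le_of_abs_dt_le hlt
      (fun t ht θ => h7 ⟨u, w, t, θ, 0⟩ (fnull t ht θ))
      (fun θ => (h0 θ).value.μ) t ht θ).trans (e3 t ht)
  have fφ : ∀ t ∈ Icc t₀ t₁, ∀ θ, |w.φ t θ| ≤ M := fun t ht θ =>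
    ((hw.φ.mono one_le_two).abs_le_of_abs_dt_le hlt
      (fun t ht θ => h8 ⟨u, w, t, θ, 0⟩ (fnull t ht θ))
      (fun θ => (h0 θ).value.φ) t ht θ).trans (e3 t ht)
  have fA : ∀ t ∈ Icc t₀ t₁, ∀ θ, |w.A t θ| ≤ M := fun t ht θ =>
    ((hw.A.mono one_le_two).abs_le_of_abs_dt_le hlt
      (fun t ht θ => h9 ⟨u, w, t, θ, 0⟩ ⟨ht2 t ht, fnull t ht θ, fμ t ht θ⟩)
      (fun θ => (h0 θ).value.A) t ht θ).trans (e3 t ht)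
  have fvalue : ∀ t ∈ Icc t₀ t₁, ∀ θ, ValueBound M w t θ := fun t ht θ =>
    ⟨fμ t ht θ, fA t ht θ, fφ t ht θ, fJ t ht θ, fK t ht θ⟩
  -- The rates of `log α` and `τ` involve the new `α e^{2τ}`, not yet bounded, so a linear growth
  -- estimate does not apply and the pair comparison takes over.
  have fmetric : ∀ t ∈ Icc t₀ t₁, ∀ θ, MetricBound M w t θ := by
    intro t ht θ
    have hsub : Icc t₀ t₁ ⊆ I := htI
    have hp := hpair t₀ t₁ e2 (fun s => Real.log (w.α s θ)) (fun s => w.τ s θ)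
      (fun s => dt I w.α s θ / w.α s θ) (fun s => dt I w.τ s θ)
      (fun s hs => ((hw.α.hasDerivWithinAt_dt one_le_two (htI s hs) θ).mono hsub).log
        (hα s hs θ).ne')
      (fun s hs => (hw.τ.hasDerivWithinAt_dt one_le_two (htI s hs) θ).mono hsub)
      (h0 θ).metric.α (h0 θ).metric.τ (fun s hs => ?_) (fun s hs => ?_) t ht
    · exact ⟨hp.1.trans hEM, hp.2.trans hEM⟩
    · have hc := h11 ⟨u, w, s, θ, 0⟩ ⟨ht2 s hs, hu s hs θ, fd s hs θ, fvalue s hs θ⟩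
      rw [hstep.dt_log_α (htI s hs) (hα s hs θ), abs_mul, Real.abs_exp]
      refine (mul_le_mul_of_nonneg_left hc (Real.exp_pos _).le).trans ?_
      linarith
    · have hc := h10 ⟨u, w, s, θ, 0⟩ ⟨ht2 s hs, hu s hs θ, fd s hs θ, fvalue s hs θ⟩
      rw [hstep.dt_τ (htI s hs) (hα s hs θ)]
      refine (abs_add_le _ _).trans ?_
      rw [mul_add C, mul_one, mul_comm C, abs_mul (Real.exp _), Real.abs_exp]
      refine add_le_add ?_ (mul_le_mul_of_nonneg_left hc (Real.exp_pos _).le)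
      have hs0 : 0 < s := ht₀.trans_le hs.1
      have hΥ : |w.Υ I s θ| ≤ M := by
        have a1 := abs_le.1 (fΥ1 s hs θ)
        have a2 := abs_le.1 (fΥ2 s hs θ)
        exact abs_le.2 ⟨by linarith, by linarith⟩
      rw [abs_mul, abs_of_pos hs0]
      refine (mul_le_mul (hs.2.trans h₁) hΥ (abs_nonneg _) ?_).trans hCM
      exact hs0.le.trans (hs.2.trans h₁)
  have smp' : ∀ t ∈ Icc t₀ t₁, ∀ θ, (⟨u, w, t, θ, 0⟩ : Sample) ∈ {i : Sample | i.t ∈ Icc t₀ t₂ ∧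
      NullBound I M i.w i.t i.θ ∧ ValueBound M i.w i.t i.θ ∧ MetricBound M i.w i.t i.θ} :=
    fun t ht θ => ⟨ht2 t ht, fnull t ht θ, fvalue t ht θ, fmetric t ht θ⟩
  have fH : ∀ t ∈ Icc t₀ t₁, ∀ θ, |w.H t θ| ≤ M := fun t ht θ =>
    ((hw.H.mono one_le_two).abs_le_of_abs_dt_le hlt (fun t ht θ =>
      (congrArg abs (hstep.dt_H (htI t ht) (ht₀.trans_le ht.1) (hα t ht θ))).trans_le <|
        h12 ⟨u, w, t, θ, 0⟩ (smp' t ht θ))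
      (fun θ => (h0 θ).shift.H) t ht θ).trans (e3 t ht)
  have fG : ∀ t ∈ Icc t₀ t₁, ∀ θ, |w.G t θ| ≤ M := fun t ht θ =>
    ((hw.G.mono one_le_two).abs_le_of_abs_dt_le hlt (fun t ht θ =>
      (congrArg abs (hstep.dt_G (htI t ht) (ht₀.trans_le ht.1) (hα t ht θ))).trans_le <|
        h13 ⟨u, w, t, θ, 0⟩ (smp' t ht θ))
      (fun θ => (h0 θ).shift.G) t ht θ).trans (e3 t ht)
  exact fun t ht θ => ⟨fd t ht θ, fnull t ht θ, fvalue t ht θ, fmetric t ht θ,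
    ⟨fG t ht θ, fH t ht θ⟩⟩

/-- The constraint equations bound the derivatives of `α` and `τ` of an iterate by the bounds for
the iterate and its predecessor. -/
lemma eventually_rateBound_step (hV : IsPotential V) (ht₀ : 0 < t₀) (ht₂ : t₂ < T) (M : ℝ) :
    ∀ᶠ M' in Filter.atTop, ∀ u w : Fields, IsStep V (Ico t₀ T) t₀ D u w →
      ∀ t ∈ Icc t₀ t₂, ∀ θ, FieldBound (Ico t₀ T) M u t θ → FieldBound (Ico t₀ T) M w t θ →
      RateBound (Ico t₀ T) M' w t θ := by
  set I := Ico t₀ T with hI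
  set S := {i : Sample | i.t ∈ Icc t₀ t₂ ∧ FieldBound I M i.u i.t i.θ ∧ FieldBound I M i.w i.t i.θ}
    with hS
  -- All terms are algebraic in quantities bounded by `M`; no smallness of time is used, so `M'` can
  -- be fixed before the length of the interval.
  obtain ⟨c1, c2, c3⟩ := bddOn_constraint_terms (S := S) hV ht₀ (fun i hi => hi.1)
    (fun i hi => hi.2.1) (fun i hi => hi.2.2.dist) (fun i hi => hi.2.2.value)
  obtain ⟨s1, s2⟩ := bddOn_time (S := S) (t := Sample.t) ht₀ (fun i hi => hi.1)
  obtain ⟨⟨a1, a2, a3, a4, a5⟩, ⟨b1, -⟩, -⟩ := bddOn_atoms (S := S) (x := Sample.w)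
    (t := Sample.t) (θ := Sample.θ) ht₀ (fun i hi => hi.1) (fun i hi => hi.2.2.null)
    (fun i hi => hi.2.2.value) (fun i hi => hi.2.2.metric)
  have y1 : BddOn S (fun i => i.w.Υ I i.t i.θ + i.w.Υx I i.t i.θ) :=
    ⟨M, fun i hi => hi.2.2.null.Υ_add⟩
  have y2 : BddOn S (fun i => i.w.Υ I i.t i.θ - i.w.Υx I i.t i.θ) :=
    ⟨M, fun i hi => hi.2.2.null.Υ_sub⟩
  have y3 : BddOn S (fun i => i.w.Υ I i.t i.θ) :=
    ((y1.add y2).mul (.const (1 / 2))).congr fun i _ => by ring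
  have y4 : BddOn S (fun i => i.w.Υx I i.t i.θ) :=
    ((y1.sub y2).mul (.const (1 / 2))).congr fun i _ => by ring
  have q : BddOn S (fun i => Real.exp (Real.log (i.w.α i.t i.θ) + 2 * i.w.τ i.t i.θ)) :=
    (a5.add ((BddOn.const 2).mul b1)).exp
  filter_upwards [(q.mul c2).eventually, ((s1.mul y3).add (q.mul c1)).eventually,
    (((s1.mul y4).div a4).sub ((a3.mul ((BddOn.const 2).mul b1).exp).mul c3)).eventually]
    with M' h1 h2 h3 u w hstep t ht θ hu hw
  have htI : t ∈ I := ⟨ht.1, ht.2.trans_lt ht₂⟩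
  have hi : (⟨u, w, t, θ, 0⟩ : Sample) ∈ S := ⟨ht, hu, hw⟩
  refine ⟨?_, ?_, ?_⟩
  · rw [hstep.dt_log_α htI hw.null.α_pos]
    exact h1 _ hi
  · rw [hstep.dt_τ htI hw.null.α_pos]
    exact h2 _ hi
  · rw [hstep.dθ_β htI]
    exact h3 _ hi

end Induction

end T2EVS

/-! ### The induction over the iterates -/

open T2EVS in
theorem mainTheorem4 (V : ℝ → ℝ) (hV : T2EVS.IsPotential V)
    (t₀ T : ℝ) (ht₀ : 0 < t₀) (hT : t₀ < T)
    (D : T2EVS.InitialData) (hD : D.IsRegular)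
    (u₀ : T2EVS.Fields) (hu₀ : u₀.IsRegular (Set.Ico t₀ T)) :
    ∃ t₁ ∈ Set.Ioo t₀ T, ∃ C : ℝ, ∀ u : ℕ → T2EVS.Fields, u 0 = u₀ →
      T2EVS.IsIteration V t₀ T D u →
      ∀ n : ℕ, ∀ t ∈ Set.Ioc t₀ t₁, ∀ θ : ℝ,
        |T2EVS.dt (Set.Ico t₀ T) (u n).μ t θ| ≤ C ∧ |T2EVS.dθ (u n).μ t θ| ≤ C ∧
        |T2EVS.dt (Set.Ico t₀ T) (u n).A t θ| ≤ C ∧ |T2EVS.dθ (u n).A t θ| ≤ C ∧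
        |T2EVS.dt (Set.Ico t₀ T) (u n).φ t θ| ≤ C ∧ |T2EVS.dθ (u n).φ t θ| ≤ C := by
  obtain ⟨t₂, h02, ht₂⟩ := exists_between hT
  obtain ⟨E, hE⟩ := (hD.eventually_fieldBound (t₀ := t₀) (Ico t₀ T)).exists
  -- The zeroth iterate need not have the prescribed initial time derivatives, so `M` must dominate
  -- its bounds as well as `E + 1`. Then `M'` is chosen from `M` and the zeroth iterate, and `δ`
  -- from `M` and `M'`.
  obtain ⟨M, hEM, hM⟩ := ((Filter.eventually_ge_atTop (E + 1)).and
    (hu₀.eventually_fieldBound ht₀ ht₂)).exists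
  obtain ⟨M', hM', hrate⟩ := ((hu₀.eventually_rateBound ht₂).and
    (eventually_rateBound_step (D := D) hV ht₀ ht₂ M)).exists
  obtain ⟨δ, hδ, hstep⟩ := exists_time_step (D := D) hV ht₀ ht₂ hEM M'
  obtain ⟨-, -, ⟨c1, c2, c3⟩, ⟨d1, d2, d3⟩⟩ := bddOn_atoms (S := {i : Sample | i.t ∈ Icc t₀ t₂ ∧
    FieldBound (Ico t₀ T) M i.u i.t i.θ}) (x := Sample.u) (t := Sample.t) (θ := Sample.θ) ht₀
    (fun i hi => hi.1) (fun i hi => hi.2.null) (fun i hi => hi.2.value) (fun i hi => hi.2.metric)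
  obtain ⟨C, ⟨h1, h2, h3⟩, h4, h5, h6⟩ := ((c1.eventually.and (c2.eventually.and
    c3.eventually)).and (d1.eventually.and (d2.eventually.and d3.eventually))).exists
  refine ⟨min t₂ (t₀ + δ), ⟨lt_min h02 (by linarith), (min_le_left _ _).trans_lt ht₂⟩, C, ?_⟩
  intro u hu0 hu
  have hsub : ∀ t ∈ Icc t₀ (min t₂ (t₀ + δ)), t ∈ Icc t₀ t₂ :=
    fun t ht => ⟨ht.1, ht.2.trans (min_le_left _ _)⟩
  have key : ∀ n, (∀ t ∈ Icc t₀ (min t₂ (t₀ + δ)), ∀ θ, FieldBound (Ico t₀ T) M (u n) t θ) ∧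
      ∀ t ∈ Icc t₀ (min t₂ (t₀ + δ)), ∀ θ, RateBound (Ico t₀ T) M' (u n) t θ := by
    intro n
    induction n with
    | zero =>
      rw [hu0]
      exact ⟨fun t ht => hM t (hsub t ht), fun t ht => hM' t (hsub t ht)⟩
    | succ n ih =>
      have hb := hstep _ (min_le_left _ _) (min_le_right _ _) (u n) (u (n + 1))
        (hu.regular (n + 1)) (hu.step n) (hu.initial (n + 1))
        (hE _ (hu.initial (n + 1)) (hu.step n).initial) ih.1 ih.2
      exact ⟨hb, fun t ht θ => hrate (u n) (u (n + 1)) (hu.step n) t (hsub t ht) θ (ih.1 t ht θ)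
        (hb t ht θ)⟩
  intro n t ht θ
  have ht' : t ∈ Icc t₀ (min t₂ (t₀ + δ)) := Ioc_subset_Icc_self ht
  -- Only the first component of the sample matters here; the second and the momentum are arbitrary
  -- fillers.
  have hi : (⟨u n, u n, t, θ, 0⟩ : Sample) ∈ {i : Sample | i.t ∈ Icc t₀ t₂ ∧
      FieldBound (Ico t₀ T) M i.u i.t i.θ} := ⟨hsub t ht', (key n).1 t ht' θ⟩
  exact ⟨h1 _ hi, h4 _ hi, h2 _ hi, h5 _ hi, h3 _ hi, h6 _ hi⟩
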